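/- For $m\ge 1$ and matrices $T_1,\dots,T_m\in M_n(\mathbb C)$ let $$\sigma_p(T_1,\dots,T_m)=\{(x_1,\dots,x_m)\in\mathbb C^m:\ x_1T_1+\dots+x_mT_m-I \text{ is not invertible}\}.$$ A matrix $h\in M_n(\mathbb C)$ is a complex Hadamard matrix if all its entries have modulus one and its rows are mutually orthogonal. Let $F_n=[e^{2\pi i jk/n}]_{j,k=0}^{n-1}$ and $D_n=\mathrm{diag}(1,e^{2\pi i/n},\dots,e^{2\pi i(n-1)/n})$. A matrix $h$ is of Fourier type if $h=\Lambda_1P_1F_nP_2\Lambda_2$ with diagonal matrices $\Lambda_1,\Lambda_2$ with unimodular diagonal entries and permutation matrices $P_1,P_2$; every such $h$ is a complex Hadamard matrix. **Theorem.** Let $A,B$ be complex $n\times n$ matrices such that $A$ is normal, $\|B\|=1$ (operator norm with respect to the Euclidean norm on $\mathbb C^n$), and $$\sigma_p(A,B,AB)=\{(x,y,z)\in\mathbb C^3:\ x^n+y^n+(-1)^{n-1}z^n=1\}.$$ Then: 1. $A$ and $B$ are unitary, and the spectrum of each of them is the set of all $n$-th roots of unity, each of (algebraic) multiplicity $1$.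 2. If $e_0,\dots,e_{n-1}$ and $\zeta_0,\dots,\zeta_{n-1}$ are bases of $\mathbb C^n$ consisting of unit vectors with $Ae_j=e^{2\pi ij/n}e_j$ and $B\zeta_j=e^{2\pi ij/n}\zeta_j$ for $j=0,\dots,n-1$, and $C=(c_{jr})$ is the transition matrix between them given by $e_r=\sum_j c_{jr}\zeta_j$, then $\sqrt n\,C$ and $\sqrt n\,C^{-1}$ are complex Hadamard matrices. 3. If $n\in\{3,4,5\}$, then $(A,B)$ is unitarily equivalent to a Hadamard pair of Fourier type: there are a unitary matrix $U$ and a complex Hadamard matrix $h$ of Fourier type with $A=UD_nU^*$ and $B=U\bigl(\tfrac1n h^*D_nh\bigr)U^*$. -/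

import Mathlib

noncomputable section

/-- The proper projective joint spectrum `σ_p` of a tuple of matrices: all points `x` for which
`∑ i, x i • T i - 1` is not invertible. -/
def properJointSpectrum {n : ℕ} {ι : Type} [Fintype ι]
    (T : ι → Matrix (Fin n) (Fin n) ℂ) : Set (ι → ℂ) :=
  {x | ¬ IsUnit (∑ i, x i • T i - 1)}

/-- The Fourier hypersurface `{x ^ n + y ^ n + (-1) ^ (n - 1) z ^ n = 1}` in `ℂ³`. -/
def fourierSurface (n : ℕ) : Set (Fin 3 → ℂ) :=
  {x | x 0 ^ n + x 1 ^ n + (-1) ^ (n - 1) * x 2 ^ n = 1}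

/-- The `n`-th root of unity `e ^ (2 π i j / n)`. -/
def unityRoot (n j : ℕ) : ℂ :=
  Complex.exp (2 * Real.pi * Complex.I * j / n)

/-- A complex Hadamard matrix: unimodular entries and mutually orthogonal rows. -/
def IsComplexHadamard {n : ℕ} (h : Matrix (Fin n) (Fin n) ℂ) : Prop :=
  (∀ i j, ‖h i j‖ = 1) ∧
    ∀ i i', i ≠ i' → ∑ j, h i j * starRingEnd ℂ (h i' j) = 0

/-- The Fourier matrix `F_n`, with rows and columns numbered from `0` to `n - 1`. -/
def fourierMatrix (n : ℕ) : Matrix (Fin n) (Fin n) ℂ :=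
  Matrix.of fun j k => unityRoot n (j * k)

/-- Similarity of Hadamard matrices: `h₂ = Λ₁ P₁ h₁ P₂ Λ₂`, where `Λ₁`, `Λ₂` are unimodular diagonal
matrices and `P₁`, `P₂` are permutation matrices. -/
def HadamardSimilar {n : ℕ} (h₁ h₂ : Matrix (Fin n) (Fin n) ℂ) : Prop :=
  ∃ (l₁ l₂ : Fin n → ℂ) (s₁ s₂ : Equiv.Perm (Fin n)),
    (∀ i, ‖l₁ i‖ = 1) ∧ (∀ i, ‖l₂ i‖ = 1) ∧
      h₂ = Matrix.diagonal l₁ * s₁.permMatrix ℂ * h₁ * s₂.permMatrix ℂ * Matrix.diagonal l₂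

/-- The diagonal matrix with the `n`-th roots of unity on the diagonal, in increasing order of
arguments. -/
def unityDiagonal (n : ℕ) : Matrix (Fin n) (Fin n) ℂ :=
  Matrix.diagonal fun j => unityRoot n j

/-- The second matrix `n⁻¹ hᴴ D h` of the pair generated by `h`; the first one is
`D = unityDiagonal n`. -/
def hadamardPartner {n : ℕ} (h : Matrix (Fin n) (Fin n) ℂ) : Matrix (Fin n) (Fin n) ℂ :=
  (n : ℂ)⁻¹ • (h.conjTranspose * unityDiagonal n * h)

/-- The pairs `(A, B)` and `(A', B')` are unitarily equivalent. -/
def PairUnitarilyEquivalent {n : ℕ} (A B A' B' : Matrix (Fin n) (Fin n) ℂ) : Prop :=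
  ∃ U ∈ Matrix.unitaryGroup (Fin n) ℂ,
    A = U * A' * U.conjTranspose ∧ B = U * B' * U.conjTranspose

end

/-! ### Roots of unity, characteristic polynomials and unitarity -/

section
open Matrix Polynomial

/-! The joint spectrum determines a determinant. By homogeneity, the nonzero eigenvalues of `x A + y
B + z A B` are exactly the nonzero solutions `t` of `t ^ n = s`, where `s = x ^ n + y ^ n + (-1) ^
(n - 1) z ^ n`, so its characteristic polynomial is `X ^ n - s`. In particular `A ^ n = B ^ n = 1`
with simple spectrum. A normal matrix with spectrum on the circle is unitary, and so is a
contraction some positive power of which is the identity.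

The moduli of the transition matrix come from the factorization `(1 - x A)(1 - y B) = 1 - x A - y B
+ x y A B`. Differentiating the determinant in `z` at `z = -x y` gives a trace identity for the
product of the two resolvents (`trace_truncatedResolvent`). With denominators cleared it extends to
inverse eigenvalues, where the resolvents become multiples of spectral projections; there it says
that every entry of `C` has squared modulus `1 / n`.

If `A` and `B` are diagonalized by unitaries `U` and `V`, the pair is generated by the Hadamard
matrix `√n Vᴴ U`, and it remains to see that this is of Fourier type. In orders 3 and 5 every
complex Hadamard matrix is. For order 5 this is Haagerup's argument: an algebraic identity makes
permutation products of equal parity coincide in 3 by 3 blocks (`even_products_coincide`), which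
forces a symmetric block and then powers of a fifth root of unity. In order 4 there is a
one-parameter family, and the determinant at `(x, y, z) = (1, 1, 0)` selects the Fourier members
(`det_four_parameter`). -/

theorem unityRoot_eq_pow (n j : ℕ) :
    unityRoot n j = Complex.exp (2 * Real.pi * Complex.I / n) ^ j := by
  rw [unityRoot, ← Complex.exp_nat_mul]; congr 1; ring

theorem unityRoot_pow (n j : ℕ) : unityRoot n j = unityRoot n 1 ^ j := by
  rw [unityRoot_eq_pow, unityRoot_eq_pow n 1, pow_one]

theorem unityRoot_primitive {n : ℕ} (hn : n ≠ 0) : IsPrimitiveRoot (unityRoot n 1) n := by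
  rw [unityRoot_eq_pow, pow_one]; exact Complex.isPrimitiveRoot_exp n hn

theorem norm_unityRoot (n j : ℕ) : ‖unityRoot n j‖ = 1 := by
  have : (2 * Real.pi * Complex.I * j / n : ℂ) = ((2 * Real.pi * j / n : ℝ) : ℂ) * Complex.I := by
    push_cast; ring
  rw [unityRoot, this, Complex.norm_exp_ofReal_mul_I]

theorem unityRoot_pow_eq_one {n : ℕ} (hn : n ≠ 0) (j : ℕ) : unityRoot n j ^ n = 1 := by
  rw [unityRoot_pow, ← pow_mul, mul_comm, pow_mul, (unityRoot_primitive hn).pow_eq_one, one_pow]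

theorem unityRoot_injective (n : ℕ) : Function.Injective fun j : Fin n => unityRoot n j := by
  intro j k h
  have hn : n ≠ 0 := by rintro rfl; exact j.elim0
  simp only [unityRoot_pow n j, unityRoot_pow n k] at h
  exact Fin.ext ((unityRoot_primitive hn).pow_inj j.2 k.2 h)

/-- The joint spectrum sees only nonzero eigenvalues and no multiplicities. For `s ≠ 0` the `n`
distinct roots of `X ^ n - s` already exhaust the degree; for `s = 0` no root but zero is left. -/
theorem charpoly_eq_X_pow_sub_C {n : ℕ} (hn : n ≠ 0) (M : Matrix (Fin n) (Fin n) ℂ) (s : ℂ)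
    (h : ∀ t, t ≠ 0 → (M.charpoly.IsRoot t ↔ t ^ n = s)) : M.charpoly = X ^ n - C s := by
  have hM := M.charpoly_monic
  have hdeg : M.charpoly.natDegree = n := by simp
  by_cases hs : s = 0
  · have hroots : M.charpoly.roots = Multiset.replicate n 0 := by
      rw [Multiset.eq_replicate]
      refine ⟨?_, fun b hb => ?_⟩
      · rw [IsAlgClosed.card_roots_eq_natDegree, hdeg]
      · by_contra hb0
        have := (h b hb0).1 ((mem_roots hM.ne_zero).1 hb)
        rw [hs] at this
        exact hb0 (pow_eq_zero_iff hn |>.1 this)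
    have := (IsAlgClosed.splits M.charpoly).eq_prod_roots_of_monic hM
    rw [this, hroots]; simp [hs]
  · have hq : (X ^ n - C s : ℂ[X]).Monic := monic_X_pow_sub_C s hn
    have hsep : (X ^ n - C s : ℂ[X]).Separable :=
      separable_X_pow_sub_C s (by exact_mod_cast hn) hs
    refine eq_of_monic_of_dvd_of_natDegree_le hq hM ?_ ?_
    · rw [IsAlgClosed.dvd_iff_roots_le_roots hq.ne_zero hM.ne_zero,
        Multiset.le_iff_subset (nodup_roots hsep)]
      intro t ht
      rw [mem_roots hq.ne_zero] at ht
      have ht' : t ^ n = s := by simpa [sub_eq_zero] using ht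
      rw [mem_roots hM.ne_zero, h t ?_, ht']
      rintro rfl
      exact hs (by rw [← ht', zero_pow hn])
    · rw [hdeg, natDegree_X_pow_sub_C]

theorem charpoly_of_joint_spectrum {n : ℕ} (hn : n ≠ 0) {A B : Matrix (Fin n) (Fin n) ℂ}
    (hσ : properJointSpectrum ![A, B, A * B] = fourierSurface n) (x y z : ℂ) :
    (x • A + y • B + z • (A * B)).charpoly
      = X ^ n - C (x ^ n + y ^ n + (-1) ^ (n - 1) * z ^ n) := by
  have key : ∀ x y z : ℂ, (x • A + y • B + z • (A * B) - 1).det = 0 ↔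
      x ^ n + y ^ n + (-1) ^ (n - 1) * z ^ n = 1 := by
    intro x y z
    have := Set.ext_iff.1 hσ ![x, y, z]
    simpa [properJointSpectrum, fourierSurface, Fin.sum_univ_three, Matrix.isUnit_iff_isUnit_det]
      using this
  have scale : ∀ t x y z : ℂ, t ≠ 0 → ((x • A + y • B + z • (A * B)).charpoly.IsRoot t ↔
      t ^ n = x ^ n + y ^ n + (-1) ^ (n - 1) * z ^ n) := by
    intro t x y z ht
    have e : (scalar (Fin n) t - (x • A + y • B + z • (A * B)))
        = (-t) • ((x / t) • A + (y / t) • B + (z / t) • (A * B) - 1) := by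
      simp only [smul_sub, smul_add, smul_smul]
      rw [← mul_div_assoc, ← mul_div_assoc, ← mul_div_assoc]
      simp only [neg_mul, neg_div, mul_div_cancel_left₀ _ ht, scalar_apply, ← smul_one_eq_diagonal]
      simp only [neg_smul]; abel
    rw [IsRoot.def, eval_charpoly, e, det_smul, mul_eq_zero, key]
    have h0 : ¬ ((-t) ^ Fintype.card (Fin n) = 0) := by simp [ht]
    rw [or_iff_right h0]
    simp only [div_pow]
    rw [← mul_div_assoc, ← add_div, ← add_div, div_eq_one_iff_eq (pow_ne_zero _ ht), eq_comm]
  exact charpoly_eq_X_pow_sub_C hn _ _ fun t ht => scale t x y z ht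

theorem det_of_joint_spectrum {n : ℕ} (hn : n ≠ 0) {A B : Matrix (Fin n) (Fin n) ℂ}
    (hσ : properJointSpectrum ![A, B, A * B] = fourierSurface n) (x y z : ℂ) :
    (1 - x • A - y • B - z • (A * B)).det
      = 1 - x ^ n - y ^ n - (-1) ^ (n - 1) * z ^ n := by
  have := congrArg (eval 1) (charpoly_of_joint_spectrum hn hσ x y z)
  rw [eval_charpoly] at this
  simp only [map_one, eval_sub, eval_pow, eval_X, one_pow, eval_C] at this
  rw [show 1 - x • A - y • B - z • (A * B) = 1 - (x • A + y • B + z • (A * B)) by abel, this]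
  ring

section powers
variable {n : ℕ} {M : Matrix (Fin n) (Fin n) ℂ}

theorem pow_eq_one_of_charpoly (h : M.charpoly = X ^ n - 1) : M ^ n = 1 := by
  have := M.aeval_self_charpoly
  simpa [h, sub_eq_zero] using this

theorem spectrum_of_charpoly (h : M.charpoly = X ^ n - 1) : spectrum ℂ M = {w : ℂ | w ^ n = 1} := by
  ext w
  rw [Matrix.mem_spectrum_iff_isRoot_charpoly, h]
  simp [sub_eq_zero]

theorem rootMultiplicity_of_charpoly (hn : n ≠ 0) (h : M.charpoly = X ^ n - 1) {w : ℂ}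
    (hw : w ∈ spectrum ℂ M) : M.charpoly.rootMultiplicity w = 1 := by
  have hsep : (X ^ n - C 1 : ℂ[X]).Separable :=
    separable_X_pow_sub_C 1 (by exact_mod_cast hn) one_ne_zero
  rw [Matrix.mem_spectrum_iff_isRoot_charpoly] at hw
  refine le_antisymm ?_ ((rootMultiplicity_pos M.charpoly_monic.ne_zero).2 hw)
  rw [← count_roots]
  refine Multiset.nodup_iff_count_le_one.1 (nodup_roots ?_) w
  rw [h]; simpa using hsep

/-- No vector can shrink, because `v = T ^ (n - 1) (T v)` has norm at most `‖T v‖`. -/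
theorem mem_unitaryGroup_of_contraction (hn : n ≠ 0) (h : M ^ n = 1)
    (hM : ‖Matrix.toEuclideanCLM (n := Fin n) (𝕜 := ℂ) M‖ ≤ 1) :
    M ∈ Matrix.unitaryGroup (Fin n) ℂ := by
  set T := Matrix.toEuclideanCLM (n := Fin n) (𝕜 := ℂ) M with hT
  have hTn : T ^ n = 1 := by rw [hT, ← map_pow, h, map_one]
  have hle : ∀ v, ‖T v‖ ≤ ‖v‖ := fun v => by
    simpa using (T.le_opNorm v).trans (mul_le_mul_of_nonneg_right hM (norm_nonneg v))
  have hpow : ∀ (m : ℕ) v, ‖(T ^ m) v‖ ≤ ‖v‖ := by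
    intro m
    induction m with
    | zero => intro v; simp
    | succ k ih => intro v; rw [pow_succ]; exact (ih _).trans (hle v)
  have hiso : ∀ v, ‖T v‖ = ‖v‖ := fun v => by
    refine le_antisymm (hle v) ?_
    obtain ⟨m, rfl⟩ := Nat.exists_eq_succ_of_ne_zero hn
    have := hpow m (T v)
    rwa [← mul_apply_eq_comp, ← pow_succ, hTn, one_apply_eq_self] at this
  have hstar : star T * T = 1 := by
    have := (ContinuousLinearMap.norm_map_iff_adjoint_comp_self T).1 hiso
    simpa [ContinuousLinearMap.star_eq_adjoint, ContinuousLinearMap.mul_def] using this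
  rw [Matrix.mem_unitaryGroup_iff']
  apply EquivLike.injective (Matrix.toEuclideanCLM (n := Fin n) (𝕜 := ℂ))
  rw [map_mul, map_star, map_one]
  exact hstar

open scoped Matrix.Norms.L2Operator in
theorem mem_unitaryGroup_of_isStarNormal (hn : n ≠ 0) (h : M.charpoly = X ^ n - 1)
    (hM : IsStarNormal M) : M ∈ Matrix.unitaryGroup (Fin n) ℂ := by
  rw [Matrix.unitaryGroup]
  refine unitary_iff_isStarNormal_and_spectrum_subset_unitary.2 ⟨hM, ?_⟩
  rw [spectrum_of_charpoly h]
  intro w hw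
  have : ‖w‖ = 1 := Complex.norm_eq_one_of_pow_eq_one hw hn
  rw [SetLike.mem_coe, Unitary.mem_iff]
  simp [Complex.conj_mul', Complex.mul_conj', this]

end powers

end

/-! ### Moduli of the transition matrix from traces of resolvents -/

section
open Matrix Polynomial

section
variable {n : ℕ} {A B U V : Matrix (Fin n) (Fin n) ℂ}

theorem eigenvectors_unitary (hA : A ∈ Matrix.unitaryGroup (Fin n) ℂ)
    (e : Fin n → EuclideanSpace ℂ (Fin n)) (he : ∀ j, ‖e j‖ = 1)
    (hAe : ∀ j, Matrix.toEuclideanLin A (e j) = unityRoot n j • e j) :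
    (Matrix.of fun i j => e j i) ∈ Matrix.unitaryGroup (Fin n) ℂ ∧
      A = (Matrix.of fun i j => e j i) * unityDiagonal n * (Matrix.of fun i j => e j i)ᴴ := by
  set U : Matrix (Fin n) (Fin n) ℂ := Matrix.of fun i j => e j i with hU
  have hAU : A * U = U * unityDiagonal n := by
    ext i j
    have := congrArg (fun v : EuclideanSpace ℂ (Fin n) => v i) (hAe j)
    simp only [Matrix.toLpLin_apply, Matrix.mulVec, dotProduct, PiLp.smul_apply,
      smul_eq_mul] at this
    rw [unityDiagonal, mul_diagonal, mul_apply]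
    simp only [hU, of_apply]
    rw [this, mul_comm]
  -- Since `A` preserves inner products, the Gram matrix is unchanged when its entries are
  -- multiplied by `conj ω_j * ω_k`; off the diagonal this factor is not 1, so the entry vanishes.
  have hG : (unityDiagonal n)ᴴ * (Uᴴ * U) * unityDiagonal n = Uᴴ * U := by
    rw [Matrix.mem_unitaryGroup_iff', star_eq_conjTranspose] at hA
    calc (unityDiagonal n)ᴴ * (Uᴴ * U) * unityDiagonal n
        = (U * unityDiagonal n)ᴴ * (U * unityDiagonal n) := by
          rw [conjTranspose_mul]; simp only [Matrix.mul_assoc]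
      _ = Uᴴ * (Aᴴ * A) * U := by
          rw [← hAU, conjTranspose_mul]; simp only [Matrix.mul_assoc]
      _ = Uᴴ * U := by rw [hA, Matrix.mul_one]
  have hUU : Uᴴ * U = 1 := by
    ext j k
    by_cases hjk : j = k
    · subst hjk
      rw [one_apply_eq, mul_apply]
      have h1 := EuclideanSpace.norm_sq_eq (e j)
      rw [he j] at h1
      have h2 : ((1 : ℝ) : ℂ) = ((∑ i, ‖e j i‖ ^ 2 : ℝ) : ℂ) := by rw [← h1]; norm_num
      rw [Complex.ofReal_one] at h2
      rw [h2]
      push_cast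
      exact Finset.sum_congr rfl fun i _ => by simp [hU, Complex.conj_mul']
    · rw [one_apply_ne hjk]
      have h1 := congrFun (congrFun hG j) k
      rw [unityDiagonal, diagonal_conjTranspose, mul_diagonal, diagonal_mul] at h1
      simp only [Pi.star_apply, RCLike.star_def] at h1
      by_contra hne
      have h3 : (starRingEnd ℂ (unityRoot n j)) * unityRoot n k = 1 := by
        apply mul_right_cancel₀ hne; linear_combination h1
      have h4 : unityRoot n j * starRingEnd ℂ (unityRoot n j) = 1 := by
        rw [Complex.mul_conj', norm_unityRoot]; norm_num
      have h5 : unityRoot n j = unityRoot n k := by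
        linear_combination (-unityRoot n j) * h3 + unityRoot n k * h4
      exact hjk (unityRoot_injective n h5)
  have hUu : U ∈ Matrix.unitaryGroup (Fin n) ℂ := by
    rw [Matrix.mem_unitaryGroup_iff', star_eq_conjTranspose, hUU]
  refine ⟨hUu, ?_⟩
  rw [Matrix.mem_unitaryGroup_iff, star_eq_conjTranspose] at hUu
  rw [← hAU, Matrix.mul_assoc, hUu, Matrix.mul_one]

theorem exists_unit_eigenvector {w : ℂ} (hw : A.charpoly.IsRoot w) :
    ∃ v : EuclideanSpace ℂ (Fin n), ‖v‖ = 1 ∧ Matrix.toEuclideanLin A v = w • v := by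
  rw [IsRoot.def, eval_charpoly] at hw
  obtain ⟨v, hv, hv0⟩ := Matrix.exists_mulVec_eq_zero_iff.2 hw
  have hAv : A *ᵥ v = w • v := by
    rw [sub_mulVec, sub_eq_zero] at hv0
    rw [← hv0, scalar_apply, ← smul_one_eq_diagonal, smul_mulVec, one_mulVec]
  set u : EuclideanSpace ℂ (Fin n) := WithLp.toLp 2 v with hu
  have hu0 : u ≠ 0 := by
    intro h; apply hv; simpa [hu] using h
  have hAu : Matrix.toEuclideanLin A u = w • u := by
    rw [hu, Matrix.toLpLin_apply]
    simp [hAv]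
  refine ⟨((‖u‖⁻¹ : ℝ) : ℂ) • u, ?_, ?_⟩
  · rw [norm_smul, Complex.norm_real, norm_inv, norm_norm, inv_mul_cancel₀ (norm_ne_zero_iff.2 hu0)]
  · rw [map_smul, hAu, smul_comm]

theorem exists_unitary_diagonalization (hn : n ≠ 0) (hA : A ∈ Matrix.unitaryGroup (Fin n) ℂ)
    (h : A.charpoly = X ^ n - 1) :
    ∃ U ∈ Matrix.unitaryGroup (Fin n) ℂ, A = U * unityDiagonal n * Uᴴ := by
  have : ∀ j : Fin n, ∃ v : EuclideanSpace ℂ (Fin n), ‖v‖ = 1 ∧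
      Matrix.toEuclideanLin A v = unityRoot n j • v := fun j =>
    exists_unit_eigenvector (by rw [h]; simp [unityRoot_pow_eq_one hn])
  choose e he hAe using this
  exact ⟨_, eigenvectors_unitary hA e he hAe⟩

/-- The polynomial `∑ x ^ i A ^ i`, which up to the factor `1 - x ^ n` is the resolvent of a matrix
with `A ^ n = 1`. -/
def truncatedResolvent (A : Matrix (Fin n) (Fin n) ℂ) (x : ℂ) : Matrix (Fin n) (Fin n) ℂ :=
  ∑ i ∈ Finset.range n, (x • A) ^ i

theorem sub_mul_truncatedResolvent (hA : A ^ n = 1) (x : ℂ) :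
    (1 - x • A) * truncatedResolvent A x = (1 - x ^ n) • (1 : Matrix (Fin n) (Fin n) ℂ) := by
  rw [truncatedResolvent, mul_neg_geom_sum, _root_.smul_pow, hA, sub_smul, one_smul]

theorem truncatedResolvent_mul_sub (hA : A ^ n = 1) (x : ℂ) :
    truncatedResolvent A x * (1 - x • A) = (1 - x ^ n) • (1 : Matrix (Fin n) (Fin n) ℂ) := by
  rw [truncatedResolvent, geom_sum_mul_neg, _root_.smul_pow, hA, sub_smul, one_smul]

theorem hasDerivAt_det_one_add_smul (M : Matrix (Fin n) (Fin n) ℂ) :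
    HasDerivAt (fun w : ℂ => (1 + w • M).det) M.trace 0 := by
  have h := (det (1 + (X : ℂ[X]) • M.map C)).hasDerivAt 0
  rw [Matrix.derivative_det_one_add_X_smul] at h
  refine h.congr_of_eventuallyEq (.of_forall fun w => ?_)
  change _ = eval w _
  rw [← coe_evalRingHom, RingHom.map_det]
  refine congrArg Matrix.det ?_
  ext i j
  by_cases hij : i = j <;> simp [hij, RingHom.mapMatrix_apply, one_apply] <;> exact mul_comm _ _

/-- Both sides are, up to the factor `(1 - x ^ n)(1 - y ^ n)`, the derivative at `w = 0` of one
determinant: the trace by factoring out `1 - x A` and `1 - y B`, the monomial by the spectral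
formula at `z = -x y - w`. -/
theorem trace_truncatedResolvent_of_generic (hn : n ≠ 0) (hA : A ^ n = 1) (hB : B ^ n = 1)
    (hdet : ∀ x y z : ℂ, (1 - x • A - y • B - z • (A * B)).det
      = 1 - x ^ n - y ^ n - (-1) ^ (n - 1) * z ^ n) {x y : ℂ} (hx : x ^ n ≠ 1) (hy : y ^ n ≠ 1) :
    (truncatedResolvent A x * A * B * truncatedResolvent B y).trace = n * (x * y) ^ (n - 1) := by
  have hx' : 1 - x ^ n ≠ 0 := sub_ne_zero.2 (Ne.symm hx)
  have hy' : 1 - y ^ n ≠ 0 := sub_ne_zero.2 (Ne.symm hy)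
  set M := ((1 - x ^ n)⁻¹ * (1 - y ^ n)⁻¹) •
    (truncatedResolvent A x * A * B * truncatedResolvent B y) with hM
  have hfac : ∀ w : ℂ, (1 - x • A) * (1 + w • M) * (1 - y • B)
      = 1 - x • A - y • B - (-(x * y) - w) • (A * B) := by
    intro w
    have e1 : (1 - x • A) * M * (1 - y • B) = A * B := by
      have : (1 - x • A) * M * (1 - y • B) = ((1 - x ^ n)⁻¹ * (1 - y ^ n)⁻¹) •
          (((1 - x • A) * truncatedResolvent A x) * A * B *
            (truncatedResolvent B y * (1 - y • B))) := by
        rw [hM]; simp only [Matrix.mul_smul, Matrix.smul_mul, Matrix.mul_assoc]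
      rw [this, sub_mul_truncatedResolvent hA, truncatedResolvent_mul_sub hB]
      simp only [Matrix.mul_smul, Matrix.smul_mul, smul_smul, Matrix.one_mul, Matrix.mul_one]
      rw [show (1 - x ^ n)⁻¹ * (1 - y ^ n)⁻¹ * ((1 - y ^ n) * (1 - x ^ n)) = 1 by field_simp,
        one_smul]
    have : (1 - x • A) * (1 + w • M) * (1 - y • B)
        = (1 - x • A) * (1 - y • B) + w • ((1 - x • A) * M * (1 - y • B)) := by
      rw [Matrix.mul_add, Matrix.add_mul, Matrix.mul_one, Matrix.mul_smul, Matrix.smul_mul]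
    rw [this, e1, Matrix.sub_mul, Matrix.mul_sub, Matrix.one_mul, Matrix.mul_sub, Matrix.mul_one,
      Matrix.one_mul, smul_mul_smul_comm, sub_smul, neg_smul]
    abel
  have hd : ∀ w : ℂ, (1 + w • M).det = ((1 - x ^ n)⁻¹ * (1 - y ^ n)⁻¹) *
      (1 - x ^ n - y ^ n - (-1) ^ (n - 1) * (-(x * y) - w) ^ n) := by
    intro w
    have h1 := congrArg Matrix.det (hfac w)
    have hdA := hdet x 0 0
    have hdB := hdet 0 y 0
    simp only [zero_smul, sub_zero, zero_pow hn, mul_zero] at hdA hdB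
    rw [det_mul, det_mul, hdA, hdB, hdet] at h1
    rw [← h1]; field_simp
  have h1 := hasDerivAt_det_one_add_smul M
  have h2 : HasDerivAt (fun w : ℂ => (1 + w • M).det) (((1 - x ^ n)⁻¹ * (1 - y ^ n)⁻¹) *
      (-((-1) ^ (n - 1) * (n * (-(x * y) - 0) ^ (n - 1) * -1)))) 0 := by
    simp only [hd]
    refine HasDerivAt.const_mul _ (HasDerivAt.const_sub _ (HasDerivAt.const_mul _ ?_))
    exact ((hasDerivAt_id (0 : ℂ)).const_sub _).pow n
  have h3 := h1.unique h2
  rw [hM, trace_smul, smul_eq_mul] at h3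
  rw [mul_left_cancel₀ (mul_ne_zero (inv_ne_zero hx') (inv_ne_zero hy')) h3]
  rw [sub_zero, neg_pow (x * y)]
  have : ((-1 : ℂ) ^ (n - 1)) * (-1) ^ (n - 1) = 1 := by rw [← mul_pow]; norm_num
  linear_combination (n * (x * y) ^ (n - 1)) * this

theorem continuous_truncatedResolvent (A : Matrix (Fin n) (Fin n) ℂ) :
    Continuous (truncatedResolvent A) := by
  unfold truncatedResolvent; fun_prop

theorem dense_pow_ne_one (hn : n ≠ 0) : Dense {x : ℂ | x ^ n ≠ 1} := by
  have : {x : ℂ | x ^ n ≠ 1} = {x : ℂ | x ^ n = 1}ᶜ := rfl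
  rw [this]
  refine Set.Countable.dense_compl ℂ (Set.Finite.countable ?_)
  refine (Polynomial.nthRoots n (1 : ℂ)).toFinset.finite_toSet.subset fun x hx => ?_
  simpa [Polynomial.mem_nthRoots (Nat.pos_of_ne_zero hn)] using hx

/-- The excluded values `x ^ n = 1`, `y ^ n = 1` are the ones needed later; they are reached by
continuity. -/
theorem trace_truncatedResolvent (hn : n ≠ 0) (hA : A ^ n = 1) (hB : B ^ n = 1)
    (hdet : ∀ x y z : ℂ, (1 - x • A - y • B - z • (A * B)).det
      = 1 - x ^ n - y ^ n - (-1) ^ (n - 1) * z ^ n) (x y : ℂ) :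
    (truncatedResolvent A x * A * B * truncatedResolvent B y).trace = n * (x * y) ^ (n - 1) := by
  have hcA := continuous_truncatedResolvent A
  have hcB := continuous_truncatedResolvent B
  have h1 : ∀ x : ℂ, x ^ n ≠ 1 → ∀ y,
      (truncatedResolvent A x * A * B * truncatedResolvent B y).trace = n * (x * y) ^ (n - 1) :=
    fun x hx => congrFun (Continuous.ext_on (dense_pow_ne_one hn)
      (by fun_prop) (by fun_prop)
      fun y hy => trace_truncatedResolvent_of_generic hn hA hB hdet hx hy)
  exact congrFun (Continuous.ext_on (dense_pow_ne_one hn)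
      (f := fun x => (truncatedResolvent A x * A * B * truncatedResolvent B y).trace)
      (g := fun x => n * (x * y) ^ (n - 1))
      (by fun_prop) (by fun_prop) fun x hx => h1 x hx y) x

/-- In the eigenbasis the diagonal entries are geometric sums over `n`-th roots of unity, which
vanish unless the ratio is 1. -/
theorem truncatedResolvent_conj (hU : U ∈ Matrix.unitaryGroup (Fin n) ℂ)
    (hA : A = U * unityDiagonal n * Uᴴ) (k : Fin n) :
    truncatedResolvent A (unityRoot n k)⁻¹ = (n : ℂ) • (U * Matrix.single k k 1 * Uᴴ) := by
  have hn : n ≠ 0 := by rintro rfl; exact k.elim0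
  rw [Matrix.mem_unitaryGroup_iff', star_eq_conjTranspose] at hU
  have hU2 : U * Uᴴ = 1 := mul_eq_one_comm.1 hU
  have hk0 : unityRoot n k ≠ 0 := by rw [← norm_ne_zero_iff, norm_unityRoot]; exact one_ne_zero
  have hpow : ∀ i : ℕ, ((unityRoot n k)⁻¹ • A) ^ i
      = U * diagonal (fun l : Fin n => ((unityRoot n k)⁻¹ * unityRoot n l) ^ i) * Uᴴ := by
    intro i
    induction i with
    | zero => simp [hU2]
    | succ m ih =>
      rw [pow_succ, ih, hA]
      have : U * diagonal (fun l : Fin n => ((unityRoot n k)⁻¹ * unityRoot n l) ^ m) * Uᴴ *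
          ((unityRoot n k)⁻¹ • (U * unityDiagonal n * Uᴴ)) =
          (unityRoot n k)⁻¹ • (U *
            diagonal (fun l : Fin n => ((unityRoot n k)⁻¹ * unityRoot n l) ^ m) *
            (Uᴴ * U) * unityDiagonal n * Uᴴ) := by
        rw [Matrix.mul_smul]; simp only [Matrix.mul_assoc]
      rw [this, hU, Matrix.mul_one, Matrix.mul_assoc U, unityDiagonal, diagonal_mul_diagonal,
        ← Matrix.smul_mul, ← Matrix.mul_smul, ← diagonal_smul]
      congr 3
      ext l
      simp only [Pi.smul_apply, smul_eq_mul, pow_succ]; ring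
  rw [truncatedResolvent]
  simp only [hpow]
  rw [← Finset.sum_mul, ← Finset.mul_sum, ← Matrix.smul_mul, ← Matrix.mul_smul]
  congr 2
  ext i j
  rw [Matrix.sum_apply]
  by_cases hij : i = j
  · subst hij
    simp only [diagonal_apply_eq, Matrix.smul_apply, smul_eq_mul]
    by_cases hik : i = k
    · subst hik
      simp [hk0]
    · rw [single_apply_of_ne _ _ _ _ _ (fun h => hik h.1.symm), mul_zero]
      have hne : (unityRoot n k)⁻¹ * unityRoot n i ≠ 1 := by
        intro h
        apply hik
        apply unityRoot_injective n
        field_simp at h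
        exact h
      have := geom_sum_mul ((unityRoot n k)⁻¹ * unityRoot n i) n
      rw [mul_pow, inv_pow, unityRoot_pow_eq_one hn, unityRoot_pow_eq_one hn] at this
      simp only [inv_one, one_mul, sub_self, mul_eq_zero] at this
      exact this.resolve_right (sub_ne_zero.2 hne)
  · simp only [diagonal_apply_ne _ hij, Finset.sum_const_zero, Matrix.smul_apply]
    rw [single_apply_of_ne _ _ _ _ _ (by rintro ⟨rfl, rfl⟩; exact hij rfl), smul_zero]

/-- At inverse eigenvalues the trace identity reads `n ^ 2 ω_k ω_j |c_jk| ^ 2 = n ω_k ω_j`, because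
`(ω⁻¹) ^ (n - 1) = ω` for an `n`-th root of unity. -/
theorem norm_transition_entry (hn : n ≠ 0) (hA1 : A ^ n = 1) (hB1 : B ^ n = 1)
    (hdet : ∀ x y z : ℂ, (1 - x • A - y • B - z • (A * B)).det
      = 1 - x ^ n - y ^ n - (-1) ^ (n - 1) * z ^ n)
    (hU : U ∈ Matrix.unitaryGroup (Fin n) ℂ) (hV : V ∈ Matrix.unitaryGroup (Fin n) ℂ)
    (hA : A = U * unityDiagonal n * Uᴴ) (hB : B = V * unityDiagonal n * Vᴴ) (j k : Fin n) :
    ‖(Vᴴ * U) j k‖ ^ 2 = (n : ℝ)⁻¹ := by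
  have h := trace_truncatedResolvent hn hA1 hB1 hdet (unityRoot n k)⁻¹ (unityRoot n j)⁻¹
  have hU' := hU
  have hV' := hV
  rw [Matrix.mem_unitaryGroup_iff', star_eq_conjTranspose] at hU' hV'
  rw [truncatedResolvent_conj hU hA, truncatedResolvent_conj hV hB] at h
  have e : (n : ℂ) • (U * Matrix.single k k (1 : ℂ) * Uᴴ) * A * B *
      ((n : ℂ) • (V * Matrix.single j j (1 : ℂ) * Vᴴ))
      = (n * n : ℂ) • (U * (Matrix.single k k (1 : ℂ) * unityDiagonal n * (Uᴴ * V) *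
        unityDiagonal n * Matrix.single j j (1 : ℂ) * Vᴴ)) := by
    calc _ = (n * n : ℂ) • (U * (Matrix.single k k (1 : ℂ) * (Uᴴ * U) * unityDiagonal n * (Uᴴ * V) *
        unityDiagonal n * (Vᴴ * V) * Matrix.single j j (1 : ℂ) * Vᴴ)) := by
          rw [hA, hB]
          simp only [Matrix.mul_smul, Matrix.smul_mul, smul_smul, Matrix.mul_assoc]
      _ = _ := by rw [hU', hV', Matrix.mul_one, Matrix.mul_one]
  rw [e, trace_smul, trace_mul_comm, Matrix.mul_assoc] at h
  have e2 : Matrix.single k k (1 : ℂ) * unityDiagonal n * (Uᴴ * V) *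
        unityDiagonal n * Matrix.single j j (1 : ℂ)
      = Matrix.single k j (unityRoot n k * (Uᴴ * V) k j * unityRoot n j) := by
    ext a b
    rw [unityDiagonal, Matrix.mul_assoc, Matrix.mul_assoc, Matrix.mul_assoc]
    by_cases ha : a = k
    · subst ha
      rw [single_mul_apply_same, one_mul, diagonal_mul, ← Matrix.mul_assoc]
      by_cases hb : b = j
      · subst hb
        rw [mul_single_apply_same, mul_diagonal, single_apply_same]; ring
      · rw [mul_single_apply_of_ne _ _ _ _ _ hb, mul_zero,
          single_apply_of_ne _ _ _ _ _ (by rintro ⟨-, rfl⟩; exact hb rfl)]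
    · rw [single_mul_apply_of_ne _ _ _ _ _ ha,
        single_apply_of_ne _ _ _ _ _ (by rintro ⟨rfl, -⟩; exact ha rfl)]
  have e3 : (Uᴴ * V) k j = star ((Vᴴ * U) j k) := by
    rw [← conjTranspose_apply, conjTranspose_mul, conjTranspose_conjTranspose]
  rw [e2, trace_single_mul, e3] at h
  have hk0 : unityRoot n k ≠ 0 := by rw [← norm_ne_zero_iff, norm_unityRoot]; exact one_ne_zero
  have hj0 : unityRoot n j ≠ 0 := by rw [← norm_ne_zero_iff, norm_unityRoot]; exact one_ne_zero
  have hpow : ((unityRoot n k)⁻¹ * (unityRoot n j)⁻¹) ^ (n - 1)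
      = unityRoot n k * unityRoot n j := by
    have h1 : ∀ l : ℕ, (unityRoot n l) ^ (n - 1) * unityRoot n l = 1 := fun l => by
      rw [← pow_succ, Nat.sub_add_cancel (Nat.pos_of_ne_zero hn), unityRoot_pow_eq_one hn]
    rw [mul_pow, inv_pow, inv_pow, eq_inv_of_mul_eq_one_left (h1 k), 
      eq_inv_of_mul_eq_one_left (h1 j), inv_inv, inv_inv]
  rw [hpow] at h
  have hn' : (n : ℂ) ≠ 0 := by exact_mod_cast hn
  have h6 : (Vᴴ * U) j k * star ((Vᴴ * U) j k) = (n : ℂ)⁻¹ := by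
    refine eq_inv_of_mul_eq_one_left ?_
    apply mul_left_cancel₀ (mul_ne_zero (mul_ne_zero hn' hk0) hj0)
    simp only [smul_eq_mul] at h
    linear_combination h
  rw [RCLike.star_def, Complex.mul_conj'] at h6
  apply Complex.ofReal_injective
  rw [Complex.ofReal_pow, h6, Complex.ofReal_inv, Complex.ofReal_natCast]

theorem det_transition (hdet : ∀ x y z : ℂ, (1 - x • A - y • B - z • (A * B)).det
      = 1 - x ^ n - y ^ n - (-1) ^ (n - 1) * z ^ n) (hn : n ≠ 0)
    (hU : U ∈ Matrix.unitaryGroup (Fin n) ℂ) (hV : V ∈ Matrix.unitaryGroup (Fin n) ℂ)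
    (hA : A = U * unityDiagonal n * Uᴴ) (hB : B = V * unityDiagonal n * Vᴴ) (x y : ℂ) :
    (Matrix.of fun j k : Fin n => (Vᴴ * U) j k * (1 - x * unityRoot n k - y * unityRoot n j)).det
      = (Vᴴ * U).det * (1 - x ^ n - y ^ n) := by
  rw [Matrix.mem_unitaryGroup_iff', star_eq_conjTranspose] at hU hV
  have h1 := hdet x y 0
  simp only [zero_smul, sub_zero, zero_pow hn, mul_zero] at h1
  have e : (Matrix.of fun j k : Fin n => (Vᴴ * U) j k * (1 - x * unityRoot n k - y * unityRoot n j))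
      = Vᴴ * (1 - x • A - y • B) * U := by
    have : Vᴴ * (1 - x • A - y • B) * U
        = Vᴴ * U - x • (Vᴴ * U * unityDiagonal n) - y • (unityDiagonal n * (Vᴴ * U)) := by
      calc _ = Vᴴ * U - x • (Vᴴ * U * unityDiagonal n * (Uᴴ * U))
            - y • (Vᴴ * V * unityDiagonal n * (Vᴴ * U)) := by
            rw [hA, hB]
            simp only [Matrix.mul_sub, Matrix.sub_mul, Matrix.mul_smul, Matrix.smul_mul,
              Matrix.mul_assoc, Matrix.one_mul]
        _ = _ := by rw [hU, hV, Matrix.mul_one, Matrix.one_mul]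
    rw [this]
    ext j k
    rw [unityDiagonal, Matrix.sub_apply, Matrix.sub_apply, Matrix.smul_apply,
      Matrix.smul_apply, mul_diagonal, diagonal_mul, of_apply]
    simp only [smul_eq_mul]; ring
  rw [e, det_mul, det_mul, h1, det_mul]; ring

theorem isComplexHadamard_of_unitary {W : Matrix (Fin n) (Fin n) ℂ} (hn : n ≠ 0)
    (hW : W ∈ Matrix.unitaryGroup (Fin n) ℂ) (h : ∀ j k, ‖W j k‖ ^ 2 = (n : ℝ)⁻¹) :
    IsComplexHadamard ((Real.sqrt n : ℂ) • W) := by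
  have hn' : (0 : ℝ) < n := by exact_mod_cast Nat.pos_of_ne_zero hn
  refine ⟨fun j k => ?_, fun j k hjk => ?_⟩
  · rw [Matrix.smul_apply, norm_smul, Complex.norm_real, Real.norm_of_nonneg (Real.sqrt_nonneg _)]
    have : (√(n : ℝ) * ‖W j k‖) ^ 2 = 1 := by
      rw [mul_pow, h, Real.sq_sqrt hn'.le, mul_inv_cancel₀ hn'.ne']
    exact (pow_eq_one_iff_of_nonneg (by positivity) two_ne_zero).1 this
  · rw [Matrix.mem_unitaryGroup_iff, star_eq_conjTranspose] at hW
    have h1 := congrFun (congrFun hW j) k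
    rw [one_apply_ne hjk, mul_apply] at h1
    simp only [Matrix.smul_apply, smul_eq_mul, map_mul]
    rw [← mul_zero ((Real.sqrt n : ℂ) * starRingEnd ℂ (Real.sqrt n : ℂ)), ← h1, Finset.mul_sum]
    exact Finset.sum_congr rfl fun i _ => by rw [conjTranspose_apply, RCLike.star_def]; ring

end

end

/-! ### Similarity and dephasing of Hadamard matrices; order three -/

section
open Matrix

theorem hadamardSimilar_iff {n : ℕ} {h₁ h₂ : Matrix (Fin n) (Fin n) ℂ} :
    HadamardSimilar h₁ h₂ ↔ ∃ (l₁ l₂ : Fin n → ℂ) (s₁ s₂ : Equiv.Perm (Fin n)),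
      (∀ i, ‖l₁ i‖ = 1) ∧ (∀ i, ‖l₂ i‖ = 1) ∧
        ∀ i j, h₂ i j = l₁ i * h₁ (s₁ i) (s₂ j) * l₂ j := by
  have key : ∀ (l₁ l₂ : Fin n → ℂ) (s₁ s₂ : Equiv.Perm (Fin n)) i j,
      (Matrix.diagonal l₁ * s₁.permMatrix ℂ * h₁ * s₂.permMatrix ℂ * Matrix.diagonal l₂) i j
        = l₁ i * h₁ (s₁ i) (s₂.symm j) * l₂ j := by
    intro l₁ l₂ s₁ s₂ i j
    rw [mul_diagonal, Equiv.Perm.permMatrix, Equiv.Perm.permMatrix, PEquiv.mul_toMatrix_toPEquiv,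
      Matrix.mul_assoc, submatrix_apply, diagonal_mul, PEquiv.toMatrix_toPEquiv_mul,
      submatrix_apply]
    rfl
  constructor
  · rintro ⟨l₁, l₂, s₁, s₂, h1, h2, rfl⟩
    exact ⟨l₁, l₂, s₁, s₂.symm, h1, h2, key l₁ l₂ s₁ s₂⟩
  · rintro ⟨l₁, l₂, s₁, s₂, h1, h2, h⟩
    refine ⟨l₁, l₂, s₁, s₂.symm, h1, h2, ?_⟩
    ext i j
    rw [key, h, Equiv.symm_symm]

theorem HadamardSimilar.trans {n : ℕ} {h₁ h₂ h₃ : Matrix (Fin n) (Fin n) ℂ}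
    (h : HadamardSimilar h₁ h₂) (h' : HadamardSimilar h₂ h₃) : HadamardSimilar h₁ h₃ := by
  rw [hadamardSimilar_iff] at *
  obtain ⟨l₁, l₂, s₁, s₂, a1, a2, a⟩ := h
  obtain ⟨m₁, m₂, t₁, t₂, b1, b2, b⟩ := h'
  refine ⟨fun i => m₁ i * l₁ (t₁ i), fun j => l₂ (t₂ j) * m₂ j, t₁.trans s₁, t₂.trans s₂,
    fun i => by simp [a1, b1], fun j => by simp [a2, b2], fun i j => ?_⟩
  rw [b, a]; simp only [Equiv.trans_apply]; ring

theorem hadamardSimilar_submatrix {n : ℕ} (h : Matrix (Fin n) (Fin n) ℂ)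
    (s t : Equiv.Perm (Fin n)) : HadamardSimilar (h.submatrix s t) h :=
  hadamardSimilar_iff.2 ⟨1, 1, s.symm, t.symm, by simp, by simp, by simp⟩

section
variable {n : ℕ} {h : Matrix (Fin n) (Fin n) ℂ}

theorem IsComplexHadamard.ne_zero (hh : IsComplexHadamard h) (i j) : h i j ≠ 0 := by
  rw [← norm_ne_zero_iff, hh.1]; exact one_ne_zero

theorem conj_eq_inv_of_norm {z : ℂ} (hz : ‖z‖ = 1) : starRingEnd ℂ z = z⁻¹ := by
  rw [Complex.inv_def, Complex.normSq_eq_norm_sq, hz]; simp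

/-- With inverses in place of conjugates, orthogonality is a rational relation; exchanging the two
rows yields its conjugate as a second one. -/
theorem IsComplexHadamard.row_orthogonal (hh : IsComplexHadamard h) {i i' : Fin n} (hi : i ≠ i') :
    ∑ j, h i j * (h i' j)⁻¹ = 0 := by
  rw [← hh.2 i i' hi]
  exact Finset.sum_congr rfl fun j _ => by rw [conj_eq_inv_of_norm (hh.1 _ _)]

theorem IsComplexHadamard.transpose (hh : IsComplexHadamard h) : IsComplexHadamard hᵀ := by
  refine ⟨fun i j => hh.1 j i, fun i i' hi => ?_⟩
  have hn : (n : ℂ) ≠ 0 := by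
    intro h0; obtain rfl : n = 0 := by exact_mod_cast h0
    exact i.elim0
  have h1 : h * hᴴ = (n : ℂ) • 1 := by
    ext a b
    rw [mul_apply, Matrix.smul_apply]
    by_cases hab : a = b
    · subst hab
      simp [Complex.mul_conj', hh.1]
    · rw [one_apply_ne hab, smul_zero, ← hh.2 a b hab]
      rfl
  have h2 : ((n : ℂ)⁻¹ • hᴴ) * h = 1 := by
    rw [mul_eq_one_comm, Matrix.mul_smul, h1, smul_smul, inv_mul_cancel₀ hn, one_smul]
  have h3 := congrFun (congrFun h2 i') i
  rw [Matrix.smul_mul, Matrix.smul_apply, one_apply_ne hi.symm, smul_eq_mul,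
    mul_eq_zero_iff_left (inv_ne_zero hn), mul_apply] at h3
  rw [← h3]
  exact Finset.sum_congr rfl fun j _ => by
    rw [conjTranspose_apply, transpose_apply, transpose_apply, mul_comm]; rfl

theorem IsComplexHadamard.of_similar {h' : Matrix (Fin n) (Fin n) ℂ} (hh : IsComplexHadamard h)
    (hs : HadamardSimilar h h') : IsComplexHadamard h' := by
  obtain ⟨l₁, l₂, s, t, h1, h2, e⟩ := hadamardSimilar_iff.1 hs
  refine ⟨fun i j => by simp [e, h1, h2, hh.1], fun i i' hi => ?_⟩
  have h3 := hh.2 (s i) (s i') (s.injective.ne hi)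
  rw [← Equiv.sum_comp t] at h3
  rw [← mul_zero (l₁ i * starRingEnd ℂ (l₁ i')), ← h3, Finset.mul_sum]
  refine Finset.sum_congr rfl fun j _ => ?_
  have h4 : l₂ j * starRingEnd ℂ (l₂ j) = 1 := by rw [Complex.mul_conj', h2]; norm_num
  rw [e, e]; simp only [map_mul]
  linear_combination (l₁ i * h (s i) (t j) * starRingEnd ℂ (l₁ i') *
    starRingEnd ℂ (h (s i') (t j))) * h4

theorem IsComplexHadamard.submatrix (hh : IsComplexHadamard h) (s t : Equiv.Perm (Fin n)) :
    IsComplexHadamard (h.submatrix s t) :=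
  hh.of_similar (hadamardSimilar_iff.2 ⟨1, 1, s, t, by simp, by simp, by simp⟩)

/-- The matrix obtained from `h` by rescaling rows and columns so that the row and the column with
index `0` consist of ones. -/
noncomputable def dephase [NeZero n] (h : Matrix (Fin n) (Fin n) ℂ) : Matrix (Fin n) (Fin n) ℂ :=
  Matrix.of fun i j => h i j * h 0 0 / (h i 0 * h 0 j)

theorem dephase_apply [NeZero n] (h : Matrix (Fin n) (Fin n) ℂ) (i j : Fin n) :
    dephase h i j = h i j * h 0 0 / (h i 0 * h 0 j) := rfl

theorem IsComplexHadamard.dephase [NeZero n] (hh : IsComplexHadamard h) :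
    IsComplexHadamard (dephase h) := by
  refine hh.of_similar (hadamardSimilar_iff.2
    ⟨fun i => h 0 0 / h i 0, fun j => (h 0 j)⁻¹, 1, 1, by simp [hh.1], by simp [hh.1],
      fun i j => ?_⟩)
  rw [dephase_apply]
  simp only [Equiv.Perm.one_apply]
  have := hh.ne_zero i 0
  have := hh.ne_zero 0 j
  field_simp

theorem IsComplexHadamard.dephase_similar [NeZero n] (hh : IsComplexHadamard h) :
    HadamardSimilar (_root_.dephase h) h := by
  refine hadamardSimilar_iff.2
    ⟨fun i => h i 0, fun j => h 0 j / h 0 0, 1, 1, by simp [hh.1], by simp [hh.1],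
      fun i j => ?_⟩
  rw [dephase_apply]
  simp only [Equiv.Perm.one_apply]
  have := hh.ne_zero i 0
  have := hh.ne_zero 0 j
  have := hh.ne_zero 0 0
  field_simp

theorem IsComplexHadamard.dephase_zero_left [NeZero n] (hh : IsComplexHadamard h) (j : Fin n) :
    _root_.dephase h 0 j = 1 := by
  have := hh.ne_zero 0 j
  have := hh.ne_zero 0 0
  rw [dephase_apply]; field_simp

theorem IsComplexHadamard.dephase_zero_right [NeZero n] (hh : IsComplexHadamard h) (i : Fin n) :
    _root_.dephase h i 0 = 1 := by
  have := hh.ne_zero i 0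
  have := hh.ne_zero 0 0
  rw [dephase_apply]; field_simp

theorem isPrimitiveRoot_of_pow_prime {p : ℕ} (hp : p.Prime) {a : ℂ} (ha : a ^ p = 1) (h1 : a ≠ 1) :
    IsPrimitiveRoot a p := by
  have : Fact p.Prime := ⟨hp⟩
  rw [← orderOf_eq_prime ha h1]
  exact IsPrimitiveRoot.orderOf a

/-- The root `a` need not be `exp (2 π i / n)`: passing to another primitive root only permutes the
columns. -/
theorem hadamardSimilar_fourierMatrix_of_pow {a : ℂ} (ha : IsPrimitiveRoot a n)
    (s t : Equiv.Perm (Fin n)) (hst : ∀ i j, h i j = a ^ (((s i : ℕ) * t j) % n)) :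
    HadamardSimilar (fourierMatrix n) h := by
  rcases Nat.eq_zero_or_pos n with rfl | hn
  · exact hadamardSimilar_iff.2 ⟨1, 1, 1, 1, by simp, by simp, fun i => i.elim0⟩
  have : NeZero n := ⟨hn.ne'⟩
  have hω := unityRoot_primitive hn.ne'
  have hex : ∀ j : Fin n, ∃ k : Fin n, unityRoot n 1 ^ (k : ℕ) = a ^ (j : ℕ) := fun j => by
    obtain ⟨k, hk, e⟩ := hω.eq_pow_of_pow_eq_one
      (ξ := a ^ (j : ℕ)) (by rw [← pow_mul, mul_comm, pow_mul, ha.pow_eq_one, one_pow])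
    exact ⟨⟨k, hk⟩, e⟩
  choose f hf using hex
  have hinj : Function.Injective f := fun j k hjk =>
    Fin.ext (ha.pow_inj j.2 k.2 (by rw [← hf, ← hf, hjk]))
  let F : Equiv.Perm (Fin n) := Equiv.ofBijective f (Finite.injective_iff_bijective.1 hinj)
  refine hadamardSimilar_iff.2 ⟨1, 1, s, t.trans F, by simp, by simp, fun i j => ?_⟩
  have e1 : ((t.trans F) j : Fin n) = f (t j) := rfl
  rw [hst, ← pow_eq_pow_mod _ ha.pow_eq_one, fourierMatrix, of_apply, unityRoot_pow, e1,
    mul_comm (s i : ℕ), pow_mul, ← hf, ← pow_mul, mul_comm (s i : ℕ)]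
  simp

end

theorem hadamardSimilar_fourierMatrix_three {h : Matrix (Fin 3) (Fin 3) ℂ}
    (hh : IsComplexHadamard h) : HadamardSimilar (fourierMatrix 3) h := by
  refine HadamardSimilar.trans ?_ hh.dephase_similar
  have hg := hh.dephase
  have h0 := hh.dephase_zero_left
  have h0' := hh.dephase_zero_right
  generalize dephase h = g at hg h0 h0'
  have r1 := hg.row_orthogonal (i := 1) (i' := 0) (by decide)
  have r1' := hg.row_orthogonal (i := 0) (i' := 1) (by decide)
  have c1 := hg.transpose.row_orthogonal (i := 1) (i' := 0) (by decide)
  have c2 := hg.transpose.row_orthogonal (i := 2) (i' := 0) (by decide)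
  have hb0 := hg.ne_zero 1 1
  have hc0 := hg.ne_zero 1 2
  simp only [Fin.sum_univ_three, transpose_apply, h0, h0', inv_one, mul_one, one_mul]
    at r1 r1' c1 c2
  have hprod : g 1 1 * g 1 2 = 1 := by
    field_simp at r1'
    linear_combination r1' - r1
  have e12 : g 1 2 = g 1 1 ^ 2 := by linear_combination -(g 1 1) * r1 + r1 + hprod
  have e21 : g 2 1 = g 1 1 ^ 2 := by linear_combination e12 + c1 - r1
  have e22 : g 2 2 = g 1 1 := by linear_combination c2 - r1
  have hcube : g 1 1 ^ 3 = 1 := by rw [pow_succ', ← e12, hprod]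
  have hne : g 1 1 ≠ 1 := by
    intro h1
    rw [e12, h1] at r1
    norm_num at r1
  refine hadamardSimilar_fourierMatrix_of_pow (a := g 1 1)
    (isPrimitiveRoot_of_pow_prime Nat.prime_three hcube hne) 1 1 fun i j => ?_
  fin_cases i <;> fin_cases j <;> simp [h0, h0', e12, e21, e22]

end

/-! ### Order four: the one-parameter family and the determinant condition -/

section
open Matrix

/-- The one-parameter family of complex Hadamard matrices of order four, with rows and columns
arranged so that `t = i` gives the Fourier matrix. -/
def hadamardFamilyFour (t : ℂ) : Matrix (Fin 4) (Fin 4) ℂ :=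
  !![1, 1, 1, 1; 1, t, -1, -t; 1, -1, 1, -1; 1, -t, -1, t]

/-- The two relations add up, after clearing denominators, to `(1 + a)(1 + b)(1 + c) = 0`. -/
theorem one_mem_of_sum_eq_zero {a b c : ℂ} (ha : a ≠ 0) (hb : b ≠ 0) (hc : c ≠ 0)
    (h : 1 + a + b + c = 0) (h' : 1 + a⁻¹ + b⁻¹ + c⁻¹ = 0) : a = -1 ∨ b = -1 ∨ c = -1 := by
  field_simp at h'
  have : (a + 1) * ((b + 1) * (c + 1)) = 0 := by linear_combination h + h'
  simpa [add_eq_zero_iff_eq_neg] using this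

theorem eq_neg_one_of_sum_eq_zero {a b : ℂ} (ha : ‖a‖ = 1) (hb : ‖b‖ = 1)
    (h : 1 + 1 + a + b = 0) : a = -1 ∧ b = -1 := by
  have h2 : (1 + a.re) + (1 + b.re) = 0 := by
    have := congrArg Complex.re h
    simp at this; linarith
  have h3 := Complex.abs_re_le_norm a
  have h4 := Complex.abs_re_le_norm b
  rw [ha, abs_le] at h3
  rw [hb, abs_le] at h4
  have h5 : a.re = -1 := by linarith
  have h6 : a.im = 0 := by
    have := Complex.sq_norm a
    rw [ha, Complex.normSq_apply, h5] at this
    nlinarith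
  have e : a = -1 := Complex.ext (by simp [h5]) (by simp [h6])
  exact ⟨e, by linear_combination h - e⟩

section
variable {g : Matrix (Fin 4) (Fin 4) ℂ}

/-- Rows 1 and 2 each contain a `-1`. If both lie in one column, the column sum makes its last entry
1. Otherwise the orthogonality of the two rows factors as `(1 - x)(1 - y⁻¹) = 0` with core entries
`x` and `y`. -/
theorem exists_core_entry_eq_one (hg : IsComplexHadamard g) (h0 : ∀ j, g 0 j = 1)
    (h0' : ∀ i, g i 0 = 1) : ∃ i j, i ≠ 0 ∧ j ≠ 0 ∧ g i j = 1 := by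
  have r1 := hg.row_orthogonal (i := 1) (i' := 0) (by decide)
  have r1' := hg.row_orthogonal (i := 0) (i' := 1) (by decide)
  have r2 := hg.row_orthogonal (i := 2) (i' := 0) (by decide)
  have r2' := hg.row_orthogonal (i := 0) (i' := 2) (by decide)
  have r12 := hg.row_orthogonal (i := 1) (i' := 2) (by decide)
  have c1 := hg.transpose.row_orthogonal (i := 1) (i' := 0) (by decide)
  have c2 := hg.transpose.row_orthogonal (i := 2) (i' := 0) (by decide)
  have c3 := hg.transpose.row_orthogonal (i := 3) (i' := 0) (by decide)
  simp only [Fin.sum_univ_four, transpose_apply, h0, h0', inv_one, mul_one, one_mul]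
    at r1 r1' r2 r2' r12 c1 c2 c3
  have cross : ∀ x y : ℂ, 1 - y⁻¹ - x + x * y⁻¹ = 0 → x = 1 ∨ y = 1 := by
    intro x y h
    have : (1 - x) * (1 - y⁻¹) = 0 := by linear_combination h
    rcases mul_eq_zero.1 this with h | h
    · exact Or.inl (sub_eq_zero.1 h).symm
    · exact Or.inr (inv_eq_one.1 (sub_eq_zero.1 h).symm)
  rcases one_mem_of_sum_eq_zero (hg.ne_zero _ _) (hg.ne_zero _ _) (hg.ne_zero _ _) r1 r1'
    with e1 | e1 | e1 <;>
  rcases one_mem_of_sum_eq_zero (hg.ne_zero _ _) (hg.ne_zero _ _) (hg.ne_zero _ _) r2 r2'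
    with e2 | e2 | e2
  · exact ⟨3, 1, by decide, by decide, by linear_combination c1 - e1 - e2⟩
  · have x : g 1 3 = - g 1 2 := by linear_combination r1 - e1
    have y : g 2 3 = - g 2 1 := by linear_combination r2 - e2
    rw [e1, e2, x, y] at r12
    rcases cross (g 1 2) (g 2 1)
      (by rw [inv_neg, inv_neg, inv_one] at r12; linear_combination r12) with h | h
    · exact ⟨1, 2, by decide, by decide, h⟩
    · exact ⟨2, 1, by decide, by decide, h⟩
  · have x : g 1 2 = - g 1 3 := by linear_combination r1 - e1
    have y : g 2 2 = - g 2 1 := by linear_combination r2 - e2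
    rw [e1, e2, x, y] at r12
    rcases cross (g 1 3) (g 2 1)
      (by rw [inv_neg, inv_neg, inv_one] at r12; linear_combination r12) with h | h
    · exact ⟨1, 3, by decide, by decide, h⟩
    · exact ⟨2, 1, by decide, by decide, h⟩
  · have x : g 1 3 = - g 1 1 := by linear_combination r1 - e1
    have y : g 2 3 = - g 2 2 := by linear_combination r2 - e2
    rw [e1, e2, x, y] at r12
    rcases cross (g 1 1) (g 2 2)
      (by rw [inv_neg, inv_neg, inv_one] at r12; linear_combination r12) with h | h
    · exact ⟨1, 1, by decide, by decide, h⟩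
    · exact ⟨2, 2, by decide, by decide, h⟩
  · exact ⟨3, 2, by decide, by decide, by linear_combination c2 - e1 - e2⟩
  · have x : g 1 1 = - g 1 3 := by linear_combination r1 - e1
    have y : g 2 1 = - g 2 2 := by linear_combination r2 - e2
    rw [e1, e2, x, y] at r12
    rcases cross (g 1 3) (g 2 2)
      (by rw [inv_neg, inv_neg, inv_one] at r12; linear_combination r12) with h | h
    · exact ⟨1, 3, by decide, by decide, h⟩
    · exact ⟨2, 2, by decide, by decide, h⟩
  · have x : g 1 2 = - g 1 1 := by linear_combination r1 - e1
    have y : g 2 2 = - g 2 3 := by linear_combination r2 - e2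
    rw [e1, e2, x, y] at r12
    rcases cross (g 1 1) (g 2 3)
      (by rw [inv_neg, inv_neg, inv_one] at r12; linear_combination r12) with h | h
    · exact ⟨1, 1, by decide, by decide, h⟩
    · exact ⟨2, 3, by decide, by decide, h⟩
  · have x : g 1 1 = - g 1 2 := by linear_combination r1 - e1
    have y : g 2 1 = - g 2 3 := by linear_combination r2 - e2
    rw [e1, e2, x, y] at r12
    rcases cross (g 1 2) (g 2 3)
      (by rw [inv_neg, inv_neg, inv_one] at r12; linear_combination r12) with h | h
    · exact ⟨1, 2, by decide, by decide, h⟩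
    · exact ⟨2, 3, by decide, by decide, h⟩
  · exact ⟨3, 3, by decide, by decide, by linear_combination c3 - e1 - e2⟩

theorem eq_hadamardFamilyFour_of_core (hg : IsComplexHadamard g) (h0 : ∀ j, g 0 j = 1)
    (h0' : ∀ i, g i 0 = 1) (h22 : g 2 2 = 1) : g = hadamardFamilyFour (g 1 1) := by
  have r1 := hg.row_orthogonal (i := 1) (i' := 0) (by decide)
  have r2 := hg.row_orthogonal (i := 2) (i' := 0) (by decide)
  have r3 := hg.row_orthogonal (i := 3) (i' := 0) (by decide)
  have c1 := hg.transpose.row_orthogonal (i := 1) (i' := 0) (by decide)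
  have c2 := hg.transpose.row_orthogonal (i := 2) (i' := 0) (by decide)
  simp only [Fin.sum_univ_four, transpose_apply, h0, h0', inv_one, mul_one]
    at r1 r2 r3 c1 c2
  obtain ⟨e21, e23⟩ := eq_neg_one_of_sum_eq_zero (hg.1 2 1) (hg.1 2 3)
    (by linear_combination r2 - h22)
  obtain ⟨e12, e32⟩ := eq_neg_one_of_sum_eq_zero (hg.1 1 2) (hg.1 3 2)
    (by linear_combination c2 - h22)
  have e13 : g 1 3 = -g 1 1 := by linear_combination r1 - e12
  have e31 : g 3 1 = -g 1 1 := by linear_combination c1 - e21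
  have e33 : g 3 3 = g 1 1 := by linear_combination r3 - e31 - e32
  ext i j
  fin_cases i <;> fin_cases j <;>
    simp [hadamardFamilyFour, h0, h0', h22, e21, e23, e12, e32, e13, e31, e33]

theorem exists_eq_submatrix_hadamardFamilyFour (hg : IsComplexHadamard g) (h0 : ∀ j, g 0 j = 1)
    (h0' : ∀ i, g i 0 = 1) : ∃ i j : Fin 4, i ≠ 0 ∧ j ≠ 0 ∧ ∃ t : ℂ, ‖t‖ = 1 ∧
      g = (hadamardFamilyFour t).submatrix (Equiv.swap i 2) (Equiv.swap j 2) := by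
  obtain ⟨i, j, hi, hj, hij⟩ := exists_core_entry_eq_one hg h0 h0'
  have hi0 : Equiv.swap i 2 0 = 0 := Equiv.swap_apply_of_ne_of_ne hi.symm (by decide)
  have hj0 : Equiv.swap j 2 0 = 0 := Equiv.swap_apply_of_ne_of_ne hj.symm (by decide)
  have hG := hg.submatrix (Equiv.swap i 2) (Equiv.swap j 2)
  refine ⟨i, j, hi, hj, _, hG.1 1 1, ?_⟩
  rw [← eq_hadamardFamilyFour_of_core hG (by simp [hi0, h0]) (by simp [hj0, h0'])
    (by simp [hij])]
  ext a b; simp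

theorem unityRoot_four (k : ℕ) : unityRoot 4 k = Complex.I ^ k := by
  rw [unityRoot_eq_pow]
  congr 1
  rw [show (2 * Real.pi * Complex.I / (4 : ℕ) : ℂ) = Real.pi / 2 * Complex.I by push_cast; ring,
    Complex.exp_pi_div_two_mul_I]

theorem det_fin_four (M : Matrix (Fin 4) (Fin 4) ℂ) : M.det =
    (M 0 0 * M 1 1 - M 0 1 * M 1 0) * (M 2 2 * M 3 3 - M 2 3 * M 3 2)
    - (M 0 0 * M 1 2 - M 0 2 * M 1 0) * (M 2 1 * M 3 3 - M 2 3 * M 3 1)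
    + (M 0 0 * M 1 3 - M 0 3 * M 1 0) * (M 2 1 * M 3 2 - M 2 2 * M 3 1)
    + (M 0 1 * M 1 2 - M 0 2 * M 1 1) * (M 2 0 * M 3 3 - M 2 3 * M 3 0)
    - (M 0 1 * M 1 3 - M 0 3 * M 1 1) * (M 2 0 * M 3 2 - M 2 2 * M 3 0)
    + (M 0 2 * M 1 3 - M 0 3 * M 1 2) * (M 2 0 * M 3 1 - M 2 1 * M 3 0) := by
  rw [det_succ_row_zero]
  simp [Fin.sum_univ_four, det_fin_three, Fin.succAbove]
  ring

/-- The weights `1 - ω_k - ω_j` depend on the order of rows and columns, so the swaps cannot be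
normalized away and all nine positions are expanded. The alternatives with `6 t` are later excluded
by `|t ^ 2 + 1| ≤ 2` on the unit circle. -/
theorem det_four_parameter {t : ℂ} {i j : Fin 4} (hi : i ≠ 0) (hj : j ≠ 0)
    (hg : g = (hadamardFamilyFour t).submatrix (Equiv.swap i 2) (Equiv.swap j 2))
    (hdet : (Matrix.of fun j k : Fin 4 => g j k * (1 - unityRoot 4 k - unityRoot 4 j)).det
      = -g.det) : t ^ 2 = -1 ∨ t ^ 2 + 1 = 6 * t ∨ t ^ 2 + 1 = -6 * t := by
  rw [det_fin_four, det_fin_four g] at hdet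
  simp only [of_apply, unityRoot_four] at hdet
  have hI := Complex.I_sq
  have hI3 : Complex.I ^ 3 = -Complex.I := by rw [pow_succ, hI]; ring
  fin_cases i <;> fin_cases j <;> first | exact absurd rfl hi | exact absurd rfl hj | skip
  all_goals
    subst hg
    simp [hadamardFamilyFour, Equiv.swap_apply_def, hI3] at hdet
    ring_nf at hdet
    simp only [hI, hI3, Complex.I_pow_four] at hdet
    ring_nf at hdet
  all_goals first
    | exact Or.inl (by linear_combination hdet / 8)
    | exact Or.inl (by linear_combination -hdet / 16)
    | exact Or.inr (Or.inl (by linear_combination -hdet / 4))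
    | exact Or.inr (Or.inr (by linear_combination -hdet / 4))

theorem sq_add_one_ne_of_norm {t : ℂ} (ht : ‖t‖ = 1) (c : ℂ) (hc : 2 < ‖c‖) :
    t ^ 2 + 1 ≠ c * t := by
  intro h
  have h1 := congrArg norm h
  have h2 := norm_add_le (t ^ 2) 1
  rw [norm_mul, ht] at h1
  rw [norm_pow, ht, norm_one] at h2
  linarith

theorem hadamardSimilar_fourierMatrix_four {h : Matrix (Fin 4) (Fin 4) ℂ}
    (hh : IsComplexHadamard h)
    (hdet : (Matrix.of fun j k : Fin 4 => h j k * (1 - unityRoot 4 k - unityRoot 4 j)).det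
      = -h.det) : HadamardSimilar (fourierMatrix 4) h := by
  refine HadamardSimilar.trans ?_ hh.dephase_similar
  have hscale : ∀ M : Matrix (Fin 4) (Fin 4) ℂ,
      (Matrix.of fun j k : Fin 4 => dephase h j k * M j k).det
        = (∏ j, h 0 0 / h j 0) * (∏ k, (h 0 k)⁻¹) *
          (Matrix.of fun j k : Fin 4 => h j k * M j k).det := by
    intro M
    rw [mul_comm (∏ j, h 0 0 / h j 0), mul_assoc, ← det_mul_column, ← det_mul_row]
    congr 1
    ext j k
    have := hh.ne_zero j 0
    have := hh.ne_zero 0 k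
    simp only [of_apply, dephase_apply]
    field_simp
  have hdet' : (Matrix.of fun j k : Fin 4 =>
      dephase h j k * (1 - unityRoot 4 k - unityRoot 4 j)).det = -(dephase h).det := by
    have h1 := hscale (Matrix.of fun j k : Fin 4 => (1 - unityRoot 4 k - unityRoot 4 j))
    have h2 := hscale (Matrix.of fun _ _ => 1)
    simp only [of_apply, mul_one] at h1 h2
    rw [h1, hdet, mul_neg]
    exact congrArg _ h2.symm
  obtain ⟨i, j, hi, hj, t, ht, e⟩ := exists_eq_submatrix_hadamardFamilyFour hh.dephase
    hh.dephase_zero_left hh.dephase_zero_right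
  have ht2 : t ^ 2 = -1 := by
    rcases det_four_parameter hi hj e hdet' with h | h | h
    · exact h
    · exact absurd h (sq_add_one_ne_of_norm ht _ (by norm_num))
    · exact absurd h (sq_add_one_ne_of_norm ht _ (by norm_num))
  have hprim : IsPrimitiveRoot t 4 := by
    have h4 : t ^ 2 ^ (1 + 1) = 1 := by
      rw [show 2 ^ (1 + 1) = 2 * 2 by norm_num, pow_mul, ht2]; norm_num
    have h2 : ¬ t ^ 2 ^ 1 = 1 := by rw [pow_one, ht2]; norm_num
    have := orderOf_eq_prime_pow h2 h4
    rw [show (4 : ℕ) = 2 ^ (1 + 1) by norm_num, ← this]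
    exact IsPrimitiveRoot.orderOf t
  have ht3 : t ^ 3 = -t := by rw [pow_succ, ht2]; ring
  have hpow : ∀ a b : Fin 4, hadamardFamilyFour t a b = t ^ (((a : ℕ) * b) % 4) := by
    intro a b
    fin_cases a <;> fin_cases b <;> simp [hadamardFamilyFour, ht2, ht3]
  rw [e]
  exact hadamardSimilar_fourierMatrix_of_pow hprim (Equiv.swap i 2) (Equiv.swap j 2)
    fun a b => hpow _ _

end

end

/-! ### Order five: every complex Hadamard matrix is of Fourier type -/

section
open Matrix

theorem pairs_eq_of_add_eq {u v w z : ℂ} (hu : u ≠ 0) (hv : v ≠ 0) (hw : w ≠ 0) (hz : z ≠ 0)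
    (h : u + v = w + z) (h' : u⁻¹ + v⁻¹ = w⁻¹ + z⁻¹) (h0 : u + v ≠ 0) :
    (w = u ∧ z = v) ∨ (w = v ∧ z = u) := by
  field_simp at h'
  have h1 : (u + v) * (w * z - u * v) = 0 := by linear_combination h' - (u * v) * h
  have h2 := (mul_eq_zero.1 h1).resolve_left h0
  have h3 : (w - u) * (w - v) = 0 := by linear_combination (-w) * h - h2
  rcases mul_eq_zero.1 h3 with e | e
  · have e := sub_eq_zero.1 e
    exact Or.inl ⟨e, by linear_combination -h - e⟩
  · have e := sub_eq_zero.1 e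
    exact Or.inr ⟨e, by linear_combination -h - e⟩

theorem add_inv_ne_neg_three {u : ℂ} (hu : ‖u‖ = 1) : u + u⁻¹ ≠ -3 := by
  intro h
  have h1 := norm_add_le u u⁻¹
  rw [h, norm_inv, hu] at h1
  norm_num at h1

/-- The product `(u + v)(w⁻¹ + z⁻¹)(w u⁻¹ + z v⁻¹)` is invariant under inverting all variables,
hence real for unimodular ones. Orthogonality rewrites each factor in terms of `a`, `b`, `c`, `d`
alone. -/
theorem reality_relation {a b c d u v w z : ℂ} (ha : a ≠ 0) (hb : b ≠ 0) (hc : c ≠ 0) (hd : d ≠ 0)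
    (hu : u ≠ 0) (hv : v ≠ 0) (hw : w ≠ 0) (hz : z ≠ 0)
    (h1 : 1 + a + b + u + v = 0) (h1' : 1 + a⁻¹ + b⁻¹ + u⁻¹ + v⁻¹ = 0)
    (h2 : 1 + c + d + w + z = 0) (h2' : 1 + c⁻¹ + d⁻¹ + w⁻¹ + z⁻¹ = 0)
    (h3 : 1 + a * c⁻¹ + b * d⁻¹ + u * w⁻¹ + v * z⁻¹ = 0)
    (h3' : 1 + c * a⁻¹ + d * b⁻¹ + w * u⁻¹ + z * v⁻¹ = 0) :
    b⁻¹ * c⁻¹ * d + a⁻¹ * c * d⁻¹ + a * b⁻¹ * d + a⁻¹ * b * c + a * d⁻¹ + b * c⁻¹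
      = b * c * d⁻¹ + a * c⁻¹ * d + a⁻¹ * b * d⁻¹ + a * b⁻¹ * c⁻¹ + a⁻¹ * d + b⁻¹ * c := by
  have e1 : 1 + a + b = -(u + v) := by linear_combination h1
  have e1' : 1 + a⁻¹ + b⁻¹ = -(u⁻¹ + v⁻¹) := by linear_combination h1'
  have e2 : 1 + c + d = -(w + z) := by linear_combination h2
  have e2' : 1 + c⁻¹ + d⁻¹ = -(w⁻¹ + z⁻¹) := by linear_combination h2'
  have e3 : 1 + a * c⁻¹ + b * d⁻¹ = -(u * w⁻¹ + v * z⁻¹) := by linear_combination h3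
  have e3' : 1 + c * a⁻¹ + d * b⁻¹ = -(w * u⁻¹ + z * v⁻¹) := by linear_combination h3'
  have hX : (1 + a + b) * (1 + c⁻¹ + d⁻¹) * (1 + c * a⁻¹ + d * b⁻¹)
      = (1 + a⁻¹ + b⁻¹) * (1 + c + d) * (1 + a * c⁻¹ + b * d⁻¹) := by
    rw [e1, e1', e2, e2', e3, e3']
    field_simp
    ring
  have hL : (1 + a + b) * (1 + c⁻¹ + d⁻¹) * (1 + c * a⁻¹ + d * b⁻¹)
      - (1 + a⁻¹ + b⁻¹) * (1 + c + d) * (1 + a * c⁻¹ + b * d⁻¹)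
      = (b⁻¹ * c⁻¹ * d + a⁻¹ * c * d⁻¹ + a * b⁻¹ * d + a⁻¹ * b * c + a * d⁻¹ + b * c⁻¹)
      - (b * c * d⁻¹ + a * c⁻¹ * d + a⁻¹ * b * d⁻¹ + a * b⁻¹ * c⁻¹ + a⁻¹ * d + b⁻¹ * c) := by
    field_simp
    ring
  rw [hX, sub_self] at hL
  exact sub_eq_zero.1 hL.symm

section
variable {g : Matrix (Fin 5) (Fin 5) ℂ}

/-- The numbers `a d`, `b`, `c` are the products over even permutations in the leading 3 by 3 block;
their Vandermonde product is shown to vanish. -/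
theorem even_products_coincide (hg : IsComplexHadamard g) (h0 : ∀ j, g 0 j = 1)
    (h0' : ∀ i, g i 0 = 1) :
    g 1 1 * g 2 2 = g 1 2 ∨ g 1 2 = g 2 1 ∨ g 2 1 = g 1 1 * g 2 2 := by
  have hr := @fun i i' => hg.row_orthogonal (i := i) (i' := i')
  have hc := @fun i i' => hg.transpose.row_orthogonal (i := i) (i' := i')
  simp only [Fin.sum_univ_five, transpose_apply] at hr hc
  have r1 := @hr 1 0 (by decide)
  have r1' := @hr 0 1 (by decide)
  have r2 := @hr 2 0 (by decide)
  have r2' := @hr 0 2 (by decide)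
  have r3 := @hr 1 2 (by decide)
  have r3' := @hr 2 1 (by decide)
  have c1 := @hc 1 0 (by decide)
  have c1' := @hc 0 1 (by decide)
  have c2 := @hc 2 0 (by decide)
  have c2' := @hc 0 2 (by decide)
  have c3 := @hc 1 2 (by decide)
  have c3' := @hc 2 1 (by decide)
  simp only [h0, h0', inv_one, mul_one, one_mul] at r1 r1' r2 r2' r3 r3' c1 c1' c2 c2' c3 c3'
  have n := hg.ne_zero
  have R := reality_relation (n _ _) (n _ _) (n _ _) (n _ _) (n _ _) (n _ _) (n _ _) (n _ _)
    r1 r1' r2 r2' r3 r3'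
  have C := reality_relation (n _ _) (n _ _) (n _ _) (n _ _) (n _ _) (n _ _) (n _ _) (n _ _)
    c1 c1' c2 c2' c3 c3'
  clear r1 r1' r2 r2' r3 r3' c1 c1' c2 c2' c3 c3' hr hc
  have na := n 1 1
  have nb := n 1 2
  have nc := n 2 1
  have nd := n 2 2
  generalize g 1 1 = a, g 1 2 = b, g 2 1 = c, g 2 2 = d at *
  -- Transposition exchanges `b` and `c`, so the difference of the row and column relations cancels
  -- all terms symmetric in them.
  have D : a⁻¹ * c * d⁻¹ + a * b⁻¹ * d + b * c⁻¹ = a * c⁻¹ * d + a⁻¹ * b * d⁻¹ + b⁻¹ * c := by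
    linear_combination (R - C) / 2
  have V : (a * d - b) * ((b - c) * (c - a * d)) = a * b * c * d *
      ((a⁻¹ * c * d⁻¹ + a * b⁻¹ * d + b * c⁻¹) - (a * c⁻¹ * d + a⁻¹ * b * d⁻¹ + b⁻¹ * c)) := by
    field_simp
    ring
  rw [D, sub_self, mul_zero] at V
  simpa [sub_eq_zero] using V

theorem even_products_coincide_of_columns (hg : IsComplexHadamard g) (h0 : ∀ j, g 0 j = 1)
    (h0' : ∀ i, g i 0 = 1) (t : Equiv.Perm (Fin 5)) (ht : t 0 = 0) :
    g 1 (t 1) * g 2 (t 2) = g 1 (t 2) ∨ g 1 (t 2) = g 2 (t 1) ∨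
      g 2 (t 1) = g 1 (t 1) * g 2 (t 2) :=
  even_products_coincide (hg.submatrix 1 t) (fun j => h0 _) (fun i => by simp [ht, h0'])

/-- The permutation of `Fin 5` which cyclically permutes the first three indices. -/
def rotateThree : Equiv.Perm (Fin 5) :=
  ⟨![1, 2, 0, 3, 4], ![2, 0, 1, 3, 4], by decide, by decide⟩

/-- The two equations are `g 1 2 = g 2 1` and `g 1 1 = g 2 2` for the permuted and dephased matrix,
with denominators cleared. Swapping two columns gives a coincidence among odd products too, and the
nine pairs of cyclic shifts of rows and columns match the nine combinations of cases. -/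
theorem exists_symmetric_block (hg : IsComplexHadamard g) (h0 : ∀ j, g 0 j = 1)
    (h0' : ∀ i, g i 0 = 1) : ∃ s t : Equiv.Perm (Fin 5),
      g (s 0) (t 1) * g (s 1) (t 2) * g (s 2) (t 0)
        = g (s 0) (t 2) * g (s 1) (t 0) * g (s 2) (t 1) ∧
      g (s 1) (t 1) * g (s 2) (t 0) * g (s 0) (t 2)
        = g (s 2) (t 2) * g (s 1) (t 0) * g (s 0) (t 1) := by
  have he := even_products_coincide_of_columns hg h0 h0' 1 rfl
  have ho := even_products_coincide_of_columns hg h0 h0' (Equiv.swap 1 2) (by decide)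
  have w1 : (Equiv.swap 1 2 : Equiv.Perm (Fin 5)) 1 = 2 := by decide
  have w2 : (Equiv.swap 1 2 : Equiv.Perm (Fin 5)) 2 = 1 := by decide
  rw [w1, w2] at ho
  simp only [Equiv.Perm.one_apply] at he
  have f0 : rotateThree 0 = 1 := rfl
  have f1 : rotateThree 1 = 2 := rfl
  have f2 : rotateThree 2 = 0 := rfl
  have i0 : rotateThree.symm 0 = 2 := rfl
  have i1 : rotateThree.symm 1 = 0 := rfl
  have i2 : rotateThree.symm 2 = 1 := rfl
  rcases he with e | e | e <;> rcases ho with o | o | o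
  · refine ⟨rotateThree, 1, ?_, ?_⟩ <;>
      simp only [f0, f1, f2, Equiv.Perm.one_apply, h0, h0', one_mul, mul_one]
    · linear_combination e
    · linear_combination o
  · refine ⟨rotateThree.symm, rotateThree, ?_, ?_⟩ <;>
      simp only [f0, f1, f2, i0, i1, i2, h0, h0', one_mul, mul_one]
    · linear_combination e
    · linear_combination o
  · refine ⟨1, rotateThree.symm, ?_, ?_⟩ <;>
      simp only [i0, i1, i2, Equiv.Perm.one_apply, h0, h0', one_mul, mul_one]
    · linear_combination e
    · linear_combination o
  · refine ⟨rotateThree.symm, rotateThree.symm, ?_, ?_⟩ <;>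
      simp only [i0, i1, i2, h0, h0', one_mul, mul_one]
    · linear_combination e
    · linear_combination o
  · refine ⟨1, 1, ?_, ?_⟩ <;>
      simp only [Equiv.Perm.one_apply, h0, h0', one_mul, mul_one]
    · linear_combination e
    · linear_combination o
  · refine ⟨rotateThree, rotateThree, ?_, ?_⟩ <;>
      simp only [f0, f1, f2, h0, h0', one_mul, mul_one]
    · linear_combination e
    · linear_combination o
  · refine ⟨1, rotateThree, ?_, ?_⟩ <;>
      simp only [f0, f1, f2, Equiv.Perm.one_apply, h0, h0', one_mul, mul_one]
    · linear_combination e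
    · linear_combination o
  · refine ⟨rotateThree, rotateThree.symm, ?_, ?_⟩ <;>
      simp only [f0, f1, f2, i0, i1, i2, h0, h0', one_mul, mul_one]
    · linear_combination e
    · linear_combination o
  · refine ⟨rotateThree.symm, 1, ?_, ?_⟩ <;>
      simp only [i0, i1, i2, Equiv.Perm.one_apply, h0, h0', one_mul, mul_one]
    · linear_combination e
    · linear_combination o

theorem exists_similar_symmetric_block {h : Matrix (Fin 5) (Fin 5) ℂ} (hh : IsComplexHadamard h) :
    ∃ g, IsComplexHadamard g ∧ HadamardSimilar g h ∧ (∀ j, g 0 j = 1) ∧ (∀ i, g i 0 = 1) ∧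
      g 1 2 = g 2 1 ∧ g 1 1 = g 2 2 := by
  have hd := hh.dephase
  obtain ⟨s, t, e, o⟩ := exists_symmetric_block hd hh.dephase_zero_left hh.dephase_zero_right
  have hs := hd.submatrix s t
  refine ⟨_, hs.dephase, hs.dephase_similar.trans
    ((hadamardSimilar_submatrix _ s t).trans hh.dephase_similar),
    hs.dephase_zero_left, hs.dephase_zero_right, ?_, ?_⟩
  · have n := hd.ne_zero
    have := n (s 1) (t 0)
    have := n (s 2) (t 0)
    have := n (s 0) (t 1)
    have := n (s 0) (t 2)
    simp only [dephase_apply (Matrix.submatrix _ _ _), submatrix_apply]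
    rw [div_eq_div_iff (by simp [*]) (by simp [*])]
    linear_combination (dephase h (s 0) (t 0)) * e
  · have n := hd.ne_zero
    have := n (s 1) (t 0)
    have := n (s 2) (t 0)
    have := n (s 0) (t 1)
    have := n (s 0) (t 2)
    simp only [dephase_apply (Matrix.submatrix _ _ _), submatrix_apply]
    rw [div_eq_div_iff (by simp [*]) (by simp [*])]
    linear_combination (dephase h (s 0) (t 0)) * o

end

/-- A repeated entry `y` would give `y + y⁻¹ = -3`, impossible on the unit circle. -/
theorem coincidence_absurd {x y z : ℂ} (hy : ‖y‖ = 1) (h : 1 + x + 2 * y + z = 0)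
    (h' : 1 + x⁻¹ + 2 * y⁻¹ + z⁻¹ = 0)
    (hq : 1 + x * y⁻¹ + y * x⁻¹ + y * z⁻¹ + z * y⁻¹ = 0) : False := by
  have hy0 : y ≠ 0 := by rw [← norm_ne_zero_iff, hy]; exact one_ne_zero
  have e : y * y⁻¹ = 1 := mul_inv_cancel₀ hy0
  exact add_inv_ne_neg_three hy (by linear_combination y⁻¹ * h + y * h' - hq - 4 * e)

theorem eq_or_add_eq_zero_of_mul_swap {x y z : ℂ} (hy : y ≠ 0) (h : x * y = z) (h' : x * z = y) :
    z = y ∨ z + y = 0 := by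
  have : y * ((x - 1) * (x + 1)) = 0 := by rw [← h] at h'; linear_combination h'
  rcases mul_eq_zero.1 ((mul_eq_zero.1 this).resolve_left hy) with e | e
  · exact Or.inl (by linear_combination y * e - h)
  · exact Or.inr (by linear_combination y * e - h)

theorem fifth_root_of_products {a b v w : ℂ} (hv : v ≠ 0) (h1 : a * w = v)
    (h2 : v * a = b) (h3 : v * b = w) (h4 : b * w = a) :
    a ^ 5 = 1 ∧ b = a ^ 4 ∧ v = a ^ 3 ∧ w = a ^ 2 := by
  have e1 : a ^ 2 * v = 1 := by
    apply mul_left_cancel₀ hv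
    linear_combination a * v * h2 + a * h3 + h1
  have e2 : a * b = 1 := by linear_combination e1 - a * h2
  have e3 : a ^ 3 * w = 1 := by linear_combination a ^ 2 * h1 + e1
  have e5 : a ^ 5 = 1 := by linear_combination (-a ^ 4) * h4 + a ^ 3 * w * e2 + e3
  refine ⟨e5, ?_, ?_, ?_⟩
  · linear_combination a ^ 4 * e2 - b * e5
  · linear_combination a ^ 3 * e1 - v * e5
  · linear_combination a ^ 2 * e3 - w * e5

theorem distinct_of_two_row_relations {a b v w : ℂ} (ha : ‖a‖ = 1) (hb : ‖b‖ = 1) (hv : ‖v‖ = 1)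
    (hw : ‖w‖ = 1) (hs : 1 + a + b + v + w = 0) (hs' : 1 + a⁻¹ + b⁻¹ + v⁻¹ + w⁻¹ = 0)
    (hq : 1 + a * b⁻¹ + b * a⁻¹ + v * w⁻¹ + w * v⁻¹ = 0) :
    (a ≠ b ∧ a + b ≠ 0 ∧ v ≠ w ∧ v + w ≠ 0) ∧ v ≠ a ∧ v ≠ b ∧ w ≠ a ∧ w ≠ b := by
  have z : ∀ x : ℂ, ‖x‖ = 1 → x ≠ 0 := fun x hx => by
    rw [← norm_ne_zero_iff, hx]; exact one_ne_zero
  have za := z a ha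
  have zb := z b hb
  have zv := z v hv
  have zw := z w hw
  have ia : a * a⁻¹ = 1 := mul_inv_cancel₀ za
  have iv : v * v⁻¹ = 1 := mul_inv_cancel₀ zv
  have ib : b * b⁻¹ = 1 := mul_inv_cancel₀ zb
  have iw : w * w⁻¹ = 1 := mul_inv_cancel₀ zw
  refine ⟨⟨?_, ?_, ?_, ?_⟩, ?_, ?_, ?_, ?_⟩
  · rintro rfl
    refine add_inv_ne_neg_three (u := v * w⁻¹) (by simp [hv, hw]) ?_
    rw [mul_inv, inv_inv]
    linear_combination hq - 2 * ia
  · intro h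
    obtain rfl : b = -a := by linear_combination h
    rw [inv_neg] at hs' hq
    have : (2 : ℂ) = 0 := by
      linear_combination (v⁻¹ + w⁻¹) * hs - hs' - iv - iw - hq - 2 * ia
    exact two_ne_zero this
  · rintro rfl
    refine add_inv_ne_neg_three (u := a * b⁻¹) (by simp [ha, hb]) ?_
    rw [mul_inv, inv_inv]
    linear_combination hq - 2 * iv
  · intro h
    obtain rfl : w = -v := by linear_combination h
    rw [inv_neg] at hs' hq
    have : (2 : ℂ) = 0 := by
      linear_combination (a⁻¹ + b⁻¹) * hs - hs' - ia - ib - hq - 2 * iv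
    exact two_ne_zero this
  · rintro rfl
    exact coincidence_absurd (x := b) (z := w) hv (by linear_combination hs)
      (by linear_combination hs') (by linear_combination hq)
  · rintro rfl
    exact coincidence_absurd (x := a) (z := w) hv (by linear_combination hs)
      (by linear_combination hs') (by linear_combination hq)
  · rintro rfl
    exact coincidence_absurd (x := b) (z := v) hw (by linear_combination hs)
      (by linear_combination hs') (by linear_combination hq)
  · rintro rfl
    exact coincidence_absurd (x := a) (z := v) hw (by linear_combination hs)
      (by linear_combination hs') (by linear_combination hq)

/-- The hypotheses say `(2 p + 1)(2 p' + 1) = 5` and `(2 p + 1)(2 P' + 1) = -5`. -/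
theorem sum_eq_of_orthogonal_row {p p' P' : ℂ} (h : 2 * (p * p') + p + p' = 2)
    (h' : 3 + p + P' + 2 * (p * P') = 0) : P' = -1 - p' := by
  have h1 : (2 * p + 1) * (2 * p' + 1) = 5 := by linear_combination 2 * h
  have h2 : 2 * p + 1 ≠ 0 := by rintro h0; rw [h0] at h1; norm_num at h1
  have h3 : (2 * p + 1) * (P' + 1 + p') = 0 := by linear_combination h + h'
  linear_combination (mul_eq_zero.1 h3).resolve_left h2

section
variable {g : Matrix (Fin 5) (Fin 5) ℂ}

/-- Both rows have the same remaining pair sum and inverse sum, so the pairs agree up to order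
unless the sum is zero. Equal order would force `u + u⁻¹ = -3` with `u = g 1 1 / g 1 2`. -/
theorem two_rows_of_symmetric_block (hg : IsComplexHadamard g) (h0 : ∀ j, g 0 j = 1)
    (h0' : ∀ i, g i 0 = 1) (e12 : g 1 2 = g 2 1) (e11 : g 1 1 = g 2 2) :
    g 2 3 = g 1 4 ∧ g 2 4 = g 1 3 := by
  have hr := @fun i i' => hg.row_orthogonal (i := i) (i' := i')
  simp only [Fin.sum_univ_five] at hr
  have r1 := @hr 1 0 (by decide)
  have r1' := @hr 0 1 (by decide)
  have r2 := @hr 2 0 (by decide)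
  have r2' := @hr 0 2 (by decide)
  have r3 := @hr 1 2 (by decide)
  simp only [h0, h0', inv_one, mul_one, one_mul, ← e12, ← e11] at r1 r1' r2 r2' r3
  have n := hg.ne_zero
  have i13 : g 1 3 * (g 1 3)⁻¹ = 1 := mul_inv_cancel₀ (n _ _)
  have i14 : g 1 4 * (g 1 4)⁻¹ = 1 := mul_inv_cancel₀ (n _ _)
  have i23 : g 2 3 * (g 2 3)⁻¹ = 1 := mul_inv_cancel₀ (n _ _)
  have i24 : g 2 4 * (g 2 4)⁻¹ = 1 := mul_inv_cancel₀ (n _ _)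
  have i11 : g 1 1 * (g 1 1)⁻¹ = 1 := mul_inv_cancel₀ (n _ _)
  have i12 : g 1 2 * (g 1 2)⁻¹ = 1 := mul_inv_cancel₀ (n _ _)
  by_cases hz : g 1 3 + g 1 4 = 0
  · exfalso
    have e14 : g 1 4 = - g 1 3 := by linear_combination hz
    have e24 : g 2 4 = - g 2 3 := by linear_combination r2 - r1 + hz
    rw [e14, inv_neg] at r1'
    rw [e14] at r1
    rw [e14, e24, inv_neg] at r3
    have : g 1 3 * (g 2 3)⁻¹ = 0 := by
      linear_combination (r3 - ((g 1 1)⁻¹ + (g 1 2)⁻¹) * r1 + r1' + i11 + i12) / 2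
    exact mul_ne_zero (n _ _) (inv_ne_zero (n _ _)) this
  · rcases pairs_eq_of_add_eq (n 1 3) (n 1 4) (n 2 3) (n 2 4) (by linear_combination r1 - r2)
      (by linear_combination r1' - r2') hz with ⟨a, b⟩ | ⟨a, b⟩
    · exfalso
      rw [a, b] at r3
      refine add_inv_ne_neg_three (u := g 1 1 * (g 1 2)⁻¹) (by simp [hg.1]) ?_
      rw [mul_inv, inv_inv]
      linear_combination r3 - i13 - i14
    · exact ⟨a, b⟩

/-- Adding the products of row 3 with rows 1 and 2 leaves only pair sums. These determine the pair
sums of row 3 and their inverses, hence each pair up to order. -/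
theorem orthogonal_row_entries (hg : IsComplexHadamard g) (h0 : ∀ j, g 0 j = 1)
    (h0' : ∀ i, g i 0 = 1) (e12 : g 1 2 = g 2 1) (e11 : g 1 1 = g 2 2) (e13 : g 2 3 = g 1 4)
    (e14 : g 2 4 = g 1 3) (hp : g 1 1 + g 1 2 ≠ 0) (hq : g 1 3 + g 1 4 ≠ 0) :
    ((g 3 1 = g 1 3 ∧ g 3 2 = g 1 4) ∨ (g 3 1 = g 1 4 ∧ g 3 2 = g 1 3)) ∧
      ((g 3 3 = g 1 1 ∧ g 3 4 = g 1 2) ∨ (g 3 3 = g 1 2 ∧ g 3 4 = g 1 1)) := by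
  have hr := @fun i i' => hg.row_orthogonal (i := i) (i' := i')
  simp only [Fin.sum_univ_five] at hr
  have r1 := @hr 1 0 (by decide)
  have r1' := @hr 0 1 (by decide)
  have r3 := @hr 3 0 (by decide)
  have r3' := @hr 0 3 (by decide)
  have r12 := @hr 1 2 (by decide)
  have r13 := @hr 1 3 (by decide)
  have r13' := @hr 3 1 (by decide)
  have r23 := @hr 2 3 (by decide)
  have r23' := @hr 3 2 (by decide)
  simp only [h0, h0', inv_one, mul_one, one_mul, ← e12, ← e11, e13, e14]
    at r1 r1' r3 r3' r12 r13 r13' r23 r23'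
  have n := hg.ne_zero
  have i13 : g 1 3 * (g 1 3)⁻¹ = 1 := mul_inv_cancel₀ (n _ _)
  have i14 : g 1 4 * (g 1 4)⁻¹ = 1 := mul_inv_cancel₀ (n _ _)
  have i11 : g 1 1 * (g 1 1)⁻¹ = 1 := mul_inv_cancel₀ (n _ _)
  have i12 : g 1 2 * (g 1 2)⁻¹ = 1 := mul_inv_cancel₀ (n _ _)
  have hpp : 2 * ((g 1 1 + g 1 2) * ((g 1 1)⁻¹ + (g 1 2)⁻¹)) + (g 1 1 + g 1 2)
      + ((g 1 1)⁻¹ + (g 1 2)⁻¹) = 2 := by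
    linear_combination r12 + 2 * i11 + 2 * i12 - i11 - i12 + i13 + i14
      - (g 1 3 + g 1 4) * r1' + r1 * (1 + (g 1 1)⁻¹ + (g 1 2)⁻¹)
  have hP' := sum_eq_of_orthogonal_row (P' := (g 3 1)⁻¹ + (g 3 2)⁻¹) hpp (by
    linear_combination r13 + r23 - (g 1 3 + g 1 4) * r3' + r1 * (1 + (g 3 1)⁻¹ + (g 3 2)⁻¹))
  have hP := sum_eq_of_orthogonal_row (p := (g 1 1)⁻¹ + (g 1 2)⁻¹) (p' := g 1 1 + g 1 2)
    (P' := g 3 1 + g 3 2) (by linear_combination hpp) (by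
    linear_combination r13' + r23' - ((g 1 3)⁻¹ + (g 1 4)⁻¹) * r3 + r1' * (1 + g 3 1 + g 3 2))
  exact ⟨pairs_eq_of_add_eq (n _ _) (n _ _) (n _ _) (n _ _) (by linear_combination r1 - hP)
      (by linear_combination r1' - hP') hq,
    pairs_eq_of_add_eq (n _ _) (n _ _) (n _ _) (n _ _) (by linear_combination hP - r3)
      (by linear_combination hP' - r3') hp⟩

theorem fifth_root_of_symmetric_block (hg : IsComplexHadamard g) (h0 : ∀ j, g 0 j = 1)
    (h0' : ∀ i, g i 0 = 1) (e12 : g 1 2 = g 2 1) (e11 : g 1 1 = g 2 2) (e13 : g 2 3 = g 1 4)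
    (hd : (g 1 1 ≠ g 1 2 ∧ g 1 1 + g 1 2 ≠ 0 ∧ g 1 3 ≠ g 1 4 ∧
      g 1 3 + g 1 4 ≠ 0) ∧ g 1 3 ≠ g 1 1 ∧ g 1 3 ≠ g 1 2 ∧ g 1 4 ≠ g 1 1 ∧ g 1 4 ≠ g 1 2) :
    g 1 1 ^ 5 = 1 ∧ g 1 2 = g 1 1 ^ 4 ∧
      ((g 1 3 = g 1 1 ^ 3 ∧ g 1 4 = g 1 1 ^ 2) ∨ (g 1 3 = g 1 1 ^ 2 ∧ g 1 4 = g 1 1 ^ 3)) := by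
  have E := even_products_coincide_of_columns hg h0 h0'
  have h13 := E (Equiv.swap 2 3) (by decide)
  have h31 := E ((Equiv.swap 2 3).trans (Equiv.swap 1 3)) (by decide)
  have h23 := E ((Equiv.swap 1 2).trans (Equiv.swap 1 3)) (by decide)
  have h32 := E (Equiv.swap 1 3) (by decide)
  rw [show (Equiv.swap 2 3 : Equiv.Perm (Fin 5)) 1 = 1 by decide,
    show (Equiv.swap 2 3 : Equiv.Perm (Fin 5)) 2 = 3 by decide, e13, ← e12] at h13
  rw [show ((Equiv.swap 2 3).trans (Equiv.swap 1 3) : Equiv.Perm (Fin 5)) 1 = 3 by decide,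
    show ((Equiv.swap 2 3).trans (Equiv.swap 1 3) : Equiv.Perm (Fin 5)) 2 = 1 by decide,
    e13, ← e12] at h31
  rw [show ((Equiv.swap 1 2).trans (Equiv.swap 1 3) : Equiv.Perm (Fin 5)) 1 = 2 by decide,
    show ((Equiv.swap 1 2).trans (Equiv.swap 1 3) : Equiv.Perm (Fin 5)) 2 = 3 by decide,
    e13, ← e11] at h23
  rw [show (Equiv.swap 1 3 : Equiv.Perm (Fin 5)) 1 = 3 by decide,
    show (Equiv.swap 1 3 : Equiv.Perm (Fin 5)) 2 = 2 by decide, e13, ← e11] at h32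
  have za := hg.ne_zero 1 1
  have zb := hg.ne_zero 1 2
  have zv := hg.ne_zero 1 3
  have zw := hg.ne_zero 1 4
  obtain ⟨⟨ab, apb, vw, vpw⟩, va, vb, wa, wb⟩ := hd
  clear E e12 e11 e13 h0 h0'
  generalize g 1 1 = a, g 1 2 = b, g 1 3 = v, g 1 4 = w at *
  have H1 : a * w = v ∨ a * w = b :=
    h13.imp_right fun h => (h.resolve_left vb).symm
  have H2 : v * b = a ∨ v * b = w :=
    h31.imp_right fun h => (h.resolve_left wa.symm).symm
  have H3 : b * w = v ∨ b * w = a :=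
    h23.imp_right fun h => (h.resolve_left va).symm
  have H4 : v * a = b ∨ v * a = w :=
    h32.imp_right fun h => (h.resolve_left wb.symm).symm
  -- In each excluded combination multiplication by one number swaps two others, so its square is 1
  -- and those two agree up to sign, against `hd`. Only two consistent choices remain.
  have X1 : ¬ (a * w = v ∧ v * a = w) := fun ⟨p, q⟩ => by
    rcases eq_or_add_eq_zero_of_mul_swap zw p (by linear_combination q) with h | h
    exacts [vw h, vpw h]
  have X2 : ¬ (b * w = v ∧ v * b = w) := fun ⟨p, q⟩ => by
    rcases eq_or_add_eq_zero_of_mul_swap zw p (by linear_combination q) with h | h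
    exacts [vw h, vpw h]
  have X3 : ¬ (a * w = b ∧ b * w = a) := fun ⟨p, q⟩ => by
    rcases eq_or_add_eq_zero_of_mul_swap (x := w) (z := a) zb (by linear_combination q)
      (by linear_combination p) with h | h
    exacts [ab h, apb h]
  have X4 : ¬ (v * b = a ∧ v * a = b) := fun ⟨p, q⟩ => by
    rcases eq_or_add_eq_zero_of_mul_swap zb p q with h | h
    exacts [ab h, apb h]
  rcases H1 with k1 | k1
  · have k4 := H4.resolve_right fun q => X1 ⟨k1, q⟩
    have k2 := H2.resolve_left fun q => X4 ⟨q, k4⟩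
    have k3 := H3.resolve_left fun q => X2 ⟨q, k2⟩
    obtain ⟨x, y, z, t⟩ := fifth_root_of_products zv k1 k4 k2 k3
    exact ⟨x, y, Or.inl ⟨z, t⟩⟩
  · have k3 := H3.resolve_right fun q => X3 ⟨k1, q⟩
    have k2 := H2.resolve_right fun q => X2 ⟨k3, q⟩
    have k4 := H4.resolve_left fun q => X4 ⟨k2, q⟩
    obtain ⟨x, y, z, t⟩ := fifth_root_of_products (a := a) (b := b) (v := w) (w := v) zw
      (by linear_combination k4) (by linear_combination k1) (by linear_combination k3)
      (by linear_combination k2)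
    exact ⟨x, y, Or.inr ⟨t, z⟩⟩

/-- The permutation of `Fin 5` listing `0, 1, 4, 2, 3`. -/
def multiplierOrderTwo : Equiv.Perm (Fin 5) :=
  ⟨![0, 1, 4, 2, 3], ![0, 1, 3, 4, 2], by decide, by decide⟩

/-- The permutation of `Fin 5` listing `0, 1, 4, 3, 2`. -/
def multiplierOrderThree : Equiv.Perm (Fin 5) :=
  ⟨![0, 1, 4, 3, 2], ![0, 1, 4, 3, 2], by decide, by decide⟩

theorem hadamardSimilar_fourierMatrix_of_symmetric_block (hg : IsComplexHadamard g)
    (h0 : ∀ j, g 0 j = 1) (h0' : ∀ i, g i 0 = 1) (e12 : g 1 2 = g 2 1) (e11 : g 1 1 = g 2 2) :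
    HadamardSimilar (fourierMatrix 5) g := by
  obtain ⟨e13, e14⟩ := two_rows_of_symmetric_block hg h0 h0' e12 e11
  have hr := @fun i i' => hg.row_orthogonal (i := i) (i' := i')
  have hc := @fun i => hg.transpose.row_orthogonal (i := i) (i' := 0)
  simp only [Fin.sum_univ_five, transpose_apply] at hr hc
  have r1 := @hr 1 0 (by decide)
  have r1' := @hr 0 1 (by decide)
  have r12 := @hr 1 2 (by decide)
  have r31 := @hr 3 1 (by decide)
  have c1 := @hc 1 (by decide)
  have c2 := @hc 2 (by decide)
  have c3 := @hc 3 (by decide)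
  have c4 := @hc 4 (by decide)
  simp only [h0, h0', inv_one, mul_one, one_mul, ← e12, ← e11, e13, e14]
    at r1 r1' r12 r31 c1 c2 c3 c4
  clear hr hc
  have hd := distinct_of_two_row_relations (hg.1 1 1) (hg.1 1 2) (hg.1 1 3) (hg.1 1 4) r1 r1' r12
  obtain ⟨h31, h33⟩ := orthogonal_row_entries hg h0 h0' e12 e11 e13 e14 hd.1.2.1 hd.1.2.2.2
  obtain ⟨ha5, hb, hvw⟩ := fifth_root_of_symmetric_block hg h0 h0' e12 e11 e13 hd
  have hne : g 1 1 ≠ 1 := fun h => hd.1.1 (by rw [hb, h, one_pow])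
  have hprim := isPrimitiveRoot_of_pow_prime Nat.prime_five ha5 hne
  generalize ha : g 1 1 = a at *
  have hsum : 1 + a + a ^ 2 + a ^ 3 + a ^ 4 = 0 := by
    rcases hvw with ⟨hv, hw⟩ | ⟨hv, hw⟩ <;> rw [hb, hv, hw] at r1 <;> linear_combination r1
  have i1 : a⁻¹ = a ^ 4 := (eq_inv_of_mul_eq_one_left (by linear_combination ha5)).symm
  have i2 : (a ^ 2)⁻¹ = a ^ 3 := (eq_inv_of_mul_eq_one_left (by linear_combination ha5)).symm
  have i3 : (a ^ 3)⁻¹ = a ^ 2 := (eq_inv_of_mul_eq_one_left (by linear_combination ha5)).symm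
  have i4 : (a ^ 4)⁻¹ = a := (eq_inv_of_mul_eq_one_left (by linear_combination ha5)).symm
  -- In four of the eight assignments rows 3 and 1 have product `1 + 2 x` with `x` equal to `a + a ^
  -- 4` or `a ^ 2 + a ^ 3`; this is nonzero because its square is 5. The other four are Fourier
  -- matrices up to permutation.
  have golden : ∀ x : ℂ, x ^ 2 + x - 1 = 0 → 1 + 2 * x ≠ 0 := by
    intro x hx h
    have : (5 : ℂ) = 0 := by linear_combination (1 + 2 * x) * h - 4 * hx
    norm_num at this
  have g1 := golden (a + a ^ 4) (by
    linear_combination hsum + (2 + a ^ 3) * ha5)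
  have g2 := golden (a ^ 2 + a ^ 3) (by
    linear_combination hsum + (2 + a) * ha5)
  have e41 : g 4 1 = g 3 2 := by
    rcases h31 with ⟨p, q⟩ | ⟨p, q⟩ <;> linear_combination c1 - r1 - p - q
  have e42 : g 4 2 = g 3 1 := by
    rcases h31 with ⟨p, q⟩ | ⟨p, q⟩ <;> linear_combination c2 - r1 - p - q
  have e43 : g 4 3 = g 3 4 := by
    rcases h33 with ⟨p, q⟩ | ⟨p, q⟩ <;> linear_combination c3 - r1 - p - q
  have e44 : g 4 4 = g 3 3 := by
    rcases h33 with ⟨p, q⟩ | ⟨p, q⟩ <;> linear_combination c4 - r1 - p - q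
  have e21 : g 2 1 = g 1 2 := e12.symm
  have e22 : g 2 2 = a := e11.symm
  rcases hvw with ⟨hv, hw⟩ | ⟨hv, hw⟩ <;> rcases h31 with ⟨p, q⟩ | ⟨p, q⟩ <;>
    rcases h33 with ⟨r, s⟩ | ⟨r, s⟩
  all_goals
    rw [p, q, r, s, hb, hv, hw, i1, i2, i3, i4] at r31
  · exact absurd (by linear_combination r31 - 2 * a ^ 2 * ha5) g2
  · refine hadamardSimilar_fourierMatrix_of_pow hprim multiplierOrderThree multiplierOrderThree
      fun i j => ?_
    fin_cases i <;> fin_cases j <;>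
      simp [multiplierOrderThree, h0, h0', ha, e21, e22, e13, e14, e41, e42,
        e43, e44, p, q, r, s, hb, hv, hw]
  · refine hadamardSimilar_fourierMatrix_of_pow hprim multiplierOrderTwo multiplierOrderThree
      fun i j => ?_
    fin_cases i <;> fin_cases j <;>
      simp [multiplierOrderTwo, multiplierOrderThree, h0, h0', ha, e21, e22, e13, e14, e41, e42,
        e43, e44, p, q, r, s, hb, hv, hw]
  · exact absurd (by linear_combination r31 - 2 * a ^ 1 * ha5) g1
  · exact absurd (by linear_combination r31 - 2 * a ^ 1 * ha5) g1
  · refine hadamardSimilar_fourierMatrix_of_pow hprim multiplierOrderTwo multiplierOrderTwo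
      fun i j => ?_
    fin_cases i <;> fin_cases j <;>
      simp [multiplierOrderTwo, h0, h0', ha, e21, e22, e13, e14, e41, e42,
        e43, e44, p, q, r, s, hb, hv, hw]
  · refine hadamardSimilar_fourierMatrix_of_pow hprim multiplierOrderThree multiplierOrderTwo
      fun i j => ?_
    fin_cases i <;> fin_cases j <;>
      simp [multiplierOrderThree, multiplierOrderTwo, h0, h0', ha, e21, e22, e13, e14, e41, e42,
        e43, e44, p, q, r, s, hb, hv, hw]
  · exact absurd (by linear_combination r31 - 2 * a ^ 2 * ha5) g2

theorem hadamardSimilar_fourierMatrix_five {h : Matrix (Fin 5) (Fin 5) ℂ}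
    (hh : IsComplexHadamard h) : HadamardSimilar (fourierMatrix 5) h := by
  obtain ⟨g, hg, hgh, h0, h0', e12, e11⟩ := exists_similar_symmetric_block hh
  exact (hadamardSimilar_fourierMatrix_of_symmetric_block hg h0 h0' e12 e11).trans hgh

end

end

/-! ### From unitary diagonalizations to Hadamard pairs, and the theorem -/

section
open Matrix
variable {n : ℕ} {A B U V : Matrix (Fin n) (Fin n) ℂ}

theorem toMatrix_eq_of_unitary (e ζ : Module.Basis (Fin n) ℂ (EuclideanSpace ℂ (Fin n)))
    (hV : (Matrix.of fun i j => ζ j i) ∈ Matrix.unitaryGroup (Fin n) ℂ) :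
    ζ.toMatrix e = (Matrix.of fun i j => ζ j i)ᴴ * (Matrix.of fun i j => e j i) := by
  have h : (Matrix.of fun i j => e j i) = (Matrix.of fun i j => ζ j i) * ζ.toMatrix e := by
    ext i r
    have h1 := congrArg (fun v : EuclideanSpace ℂ (Fin n) => v i) (ζ.sum_toMatrix_smul_self e r)
    simp only [WithLp.ofLp_sum, WithLp.ofLp_smul, Finset.sum_apply, Pi.smul_apply,
      smul_eq_mul] at h1
    rw [of_apply, ← h1, mul_apply]
    exact Finset.sum_congr rfl fun j _ => by rw [of_apply, mul_comm]
  rw [Matrix.mem_unitaryGroup_iff', star_eq_conjTranspose] at hV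
  rw [h, ← Matrix.mul_assoc, hV, Matrix.one_mul]

theorem norm_conjTranspose_mul_apply (U V : Matrix (Fin n) (Fin n) ℂ) (j k : Fin n) :
    ‖(Uᴴ * V) j k‖ = ‖(Vᴴ * U) k j‖ := by
  rw [← norm_star ((Vᴴ * U) k j), ← conjTranspose_apply, conjTranspose_mul,
    conjTranspose_conjTranspose]

theorem conjTranspose_mul_mem_unitaryGroup (hU : U ∈ Matrix.unitaryGroup (Fin n) ℂ)
    (hV : V ∈ Matrix.unitaryGroup (Fin n) ℂ) : Vᴴ * U ∈ Matrix.unitaryGroup (Fin n) ℂ :=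
  mul_mem (Unitary.star_mem hV) hU

theorem eq_conj_hadamardPartner (hn : n ≠ 0) (hU : U ∈ Matrix.unitaryGroup (Fin n) ℂ)
    (hB : B = V * unityDiagonal n * Vᴴ) :
    B = U * hadamardPartner ((Real.sqrt n : ℂ) • (Vᴴ * U)) * Uᴴ := by
  rw [Matrix.mem_unitaryGroup_iff, star_eq_conjTranspose] at hU
  have hn' : (n : ℂ) ≠ 0 := by exact_mod_cast hn
  have hsq : (Real.sqrt n : ℂ) * (Real.sqrt n : ℂ) = n := by
    rw [← Complex.ofReal_mul, Real.mul_self_sqrt (Nat.cast_nonneg n), Complex.ofReal_natCast]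
  have h1 : hadamardPartner ((Real.sqrt n : ℂ) • (Vᴴ * U))
      = Uᴴ * V * unityDiagonal n * (Vᴴ * U) := by
    rw [hadamardPartner, conjTranspose_smul, conjTranspose_mul, conjTranspose_conjTranspose,
      Matrix.mul_smul, Matrix.smul_mul, Matrix.smul_mul, smul_smul, smul_smul, RCLike.star_def,
      Complex.conj_ofReal, mul_assoc, hsq, inv_mul_cancel₀ hn', one_smul]
  rw [h1]
  calc B = (U * Uᴴ) * (V * unityDiagonal n * Vᴴ) * (U * Uᴴ) := by
        rw [hU, Matrix.one_mul, Matrix.mul_one, hB]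
    _ = _ := by simp only [Matrix.mul_assoc]

end

theorem mainTheorem2 (n : ℕ) (A B : Matrix (Fin n) (Fin n) ℂ)
    (hA : IsStarNormal A)
    (hB : ‖Matrix.toEuclideanCLM (n := Fin n) (𝕜 := ℂ) B‖ = 1)
    (hσ : properJointSpectrum ![A, B, A * B] = fourierSurface n) :
    (A ∈ Matrix.unitaryGroup (Fin n) ℂ ∧ B ∈ Matrix.unitaryGroup (Fin n) ℂ ∧
      spectrum ℂ A = {w : ℂ | w ^ n = 1} ∧
      spectrum ℂ B = {w : ℂ | w ^ n = 1} ∧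
      (∀ w ∈ spectrum ℂ A, A.charpoly.rootMultiplicity w = 1) ∧
      (∀ w ∈ spectrum ℂ B, B.charpoly.rootMultiplicity w = 1)) ∧
    (∀ e ζ : Module.Basis (Fin n) ℂ (EuclideanSpace ℂ (Fin n)),
      (∀ j, ‖e j‖ = 1) → (∀ j, ‖ζ j‖ = 1) →
      (∀ j, Matrix.toEuclideanLin A (e j) = unityRoot n j • e j) →
      (∀ j, Matrix.toEuclideanLin B (ζ j) = unityRoot n j • ζ j) →
      IsComplexHadamard ((Real.sqrt n : ℂ) • ζ.toMatrix e) ∧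
      IsComplexHadamard ((Real.sqrt n : ℂ) • e.toMatrix ζ)) ∧
    (n = 3 ∨ n = 4 ∨ n = 5 →
      ∃ h : Matrix (Fin n) (Fin n) ℂ, IsComplexHadamard h ∧
        HadamardSimilar (fourierMatrix n) h ∧
        PairUnitarilyEquivalent A B (unityDiagonal n) (hadamardPartner h)) := by
  -- The only 0 by 0 matrix has norm zero.
  have hn : n ≠ 0 := by
    rintro rfl
    rw [Subsingleton.elim B 0, map_zero, norm_zero] at hB
    exact zero_ne_one hB
  have hcA : A.charpoly = Polynomial.X ^ n - 1 := by
    simpa [hn] using charpoly_of_joint_spectrum hn hσ 1 0 0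
  have hcB : B.charpoly = Polynomial.X ^ n - 1 := by
    simpa [hn] using charpoly_of_joint_spectrum hn hσ 0 1 0
  have hA1 := pow_eq_one_of_charpoly hcA
  have hB1 := pow_eq_one_of_charpoly hcB
  have hAu := mem_unitaryGroup_of_isStarNormal hn hcA hA
  have hBu := mem_unitaryGroup_of_contraction hn hB1 hB.le
  have hdet := det_of_joint_spectrum hn hσ
  refine ⟨⟨hAu, hBu, spectrum_of_charpoly hcA, spectrum_of_charpoly hcB,
    fun w hw => rootMultiplicity_of_charpoly hn hcA hw,
    fun w hw => rootMultiplicity_of_charpoly hn hcB hw⟩, ?_, ?_⟩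
  · intro e ζ he hζ hAe hBζ
    obtain ⟨hU, hAU⟩ := eigenvectors_unitary hAu e he hAe
    obtain ⟨hV, hBV⟩ := eigenvectors_unitary hBu ζ hζ hBζ
    have hent := norm_transition_entry hn hA1 hB1 hdet hU hV hAU hBV
    rw [toMatrix_eq_of_unitary e ζ hV, toMatrix_eq_of_unitary ζ e hU]
    refine ⟨isComplexHadamard_of_unitary hn (conjTranspose_mul_mem_unitaryGroup hU hV) hent,
      isComplexHadamard_of_unitary hn (conjTranspose_mul_mem_unitaryGroup hV hU) fun j k => ?_⟩
    rw [norm_conjTranspose_mul_apply, hent]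
  · intro hcases
    obtain ⟨U, hU, hAU⟩ := exists_unitary_diagonalization hn hAu hcA
    obtain ⟨V, hV, hBV⟩ := exists_unitary_diagonalization hn hBu hcB
    have hH := isComplexHadamard_of_unitary hn (conjTranspose_mul_mem_unitaryGroup hU hV)
      (norm_transition_entry hn hA1 hB1 hdet hU hV hAU hBV)
    refine ⟨_, hH, ?_, U, hU, hAU, eq_conj_hadamardPartner hn hU hBV⟩
    rcases hcases with rfl | rfl | rfl
    · exact hadamardSimilar_fourierMatrix_three hH
    · refine hadamardSimilar_fourierMatrix_four hH ?_
      -- At `x = y = 1` the factor `1 - x ^ n - y ^ n` is `-1`.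
      have h1 := det_transition hdet hn hU hV hAU hBV 1 1
      simp only [one_mul, one_pow, sub_self, zero_sub, mul_neg, mul_one] at h1
      have h2 : (Matrix.of fun j k : Fin 4 =>
          ((Real.sqrt (4 : ℕ) : ℂ) • (V.conjTranspose * U)) j k *
            (1 - unityRoot 4 k - unityRoot 4 j))
          = (Real.sqrt (4 : ℕ) : ℂ) • Matrix.of fun j k : Fin 4 =>
            (V.conjTranspose * U) j k * (1 - unityRoot 4 k - unityRoot 4 j) := by
        ext j k
        simp only [Matrix.of_apply, Matrix.smul_apply, smul_eq_mul, mul_assoc]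
      rw [h2, Matrix.det_smul, Matrix.det_smul, h1, mul_neg]
    · exact hadamardSimilar_fourierMatrix_five hH
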